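/- **Theorem 2 (Intermediate value theorem for noisy estimates).** *Setting.* For each $T$ let $(\theta_i,\varepsilon_{i,T})$, $i=1,2,\dots$, be i.i.d. random vectors, where $\theta_i$ has cdf $F$ and $\varepsilon_{i,T}$ has cdf $G_T$; the dependence between $\theta_i$ and $\varepsilon_{i,T}$ is unrestricted. Let $p>0$, $\vartheta_{i,T}=\theta_i+T^{-p}\varepsilon_{i,T}$, and let $\vartheta_{1,N,T}\le\dots\le\vartheta_{N,N,T}$ be the order statistics of $\vartheta_{1,T},\dots,\vartheta_{N,T}$. For a cdf $M$ and $q\in(0,1]$ put $M^{-1}(q)=\inf\{x: M(x)\ge q\}$, and $M^{-1}(0)=\inf\{x:M(x)>0\}$, with values in $[-\infty,\infty]$. Assume the first-order von Mises condition: with $x^*=F^{-1}(1)\in(-\infty,\infty]$, in some left neighbourhood of $x^*$ the cdf $F$ is twice differentiable with density $f=F'>0$, $F$ has no atom at $x^*$ (i.e. $F(t)\to1$ as $t\uparrow x^*$), and $\lim_{t\uparrow x^*}\left(\frac{1-F}{f}\right)'(t)=\gamma$ for some $\gamma\in\mathbb R$. Let $k=k(N)\to\infty$ with $k=o(N)$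 as $N\to\infty$, let $U_F=\left(\frac1{1-F}\right)^{-1}$, and let $c_N=\frac Nk\,U_F'\!\left(\frac Nk\right)$. Let $U_1,U_2,\dots$ be i.i.d. uniform on $[0,1]$, and let $U_{k,N}$ be the $k$-th smallest of $U_1,\dots,U_N$. Limits as $N,T\to\infty$ are taken jointly or along any fixed path on which both $N\to\infty$ and $T\to\infty$. Consider the conditions, as $N,T\to\infty$, (TE-Sup, for a given $\epsilon>0$) $\displaystyle\sup_{u\in[0,\epsilon]}\frac{\sqrt k}{c_N}\left(F^{-1}(1-U_{k,N}-u)-F^{-1}(1-U_{k,N})+\frac1{T^p}G_T^{-1}(u)\right)\xrightarrow{p}0,$ (TE-Inf) $\displaystyle\inf_{u\in[0,U_{k,N}]}\frac{\sqrt k}{c_N}\left(F^{-1}(1-U_{k,N}+u)-F^{-1}(1-U_{k,N})+\frac1{T^p}G_T^{-1}(1-u)\right)\xrightarrow{p}0,$ (TE-Sup$'$) $\displaystyle\sup_{u\in[0,1-U_{k,N}]}\frac{\sqrt k}{c_N}\left(F^{-1}(1-U_{k,N}-u)-F^{-1}(1-U_{k,N})+\frac1{T^p}G_T^{-1}(u)\right)\xrightarrow{p}0.$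 (In TE-Sup, values of $u$ with $u>1-U_{k,N}$, for which $F^{-1}(1-U_{k,N}-u)$ is not defined, are disregarded.) (1) *(Transferral of convergence)* If (TE-Sup) for some $\epsilon>0$ and (TE-Inf) hold, then, whatever the joint distributions of $(\theta_i,\varepsilon_{i,T})$ with marginals $F$ and $G_T$, $$\sqrt k\;\frac{\vartheta_{N-k,N,T}-F^{-1}(1-k/N)}{c_N}\Rightarrow N(0,1)\qquad\text{as }N,T\to\infty.$$ (2) *(Sharpness)* (i) (TE-Sup) for some $\epsilon>0$ and (TE-Inf) together imply (TE-Sup$'$). (ii) If at least one of (TE-Inf) and (TE-Sup$'$) fails, then there is a sequence (indexed by $T$) of joint distributions of $(\theta_i,\varepsilon_{i,T})$ with the given marginals $F$ and $G_T$ for which $\sqrt k\,(\vartheta_{N-k,N,T}-F^{-1}(1-k/N))/c_N$ does not converge weakly to $N(0,1)$: it either converges weakly to a different limit or does not converge at all. -/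

import Mathlib

open MeasureTheory ProbabilityTheory Filter Topology Set

noncomputable section

/-- The quantile function `q ↦ μ⁻¹(q)` of a law `μ` on `ℝ` with cdf `M`, with values in `[-∞, ∞]`:
the generalized inverse `inf {x | q ≤ M x}` for `q ≠ 0`, and for `q = 0` the left endpoint
`inf {x | 0 < M x}` of the distribution. In particular `quantile μ 1` is the right endpoint. -/
def quantile (μ : Measure ℝ) (q : ℝ) : EReal :=
  if q = 0 then sInf (Real.toEReal '' {x : ℝ | 0 < cdf μ x})
  else sInf (Real.toEReal '' {x : ℝ | q ≤ cdf μ x})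

/-- The filter of left neighbourhoods, in `ℝ`, of the right endpoint of `μ`
(it is `atTop` if the right endpoint is `+∞`). -/
def leftOfEndpoint (μ : Measure ℝ) : Filter ℝ :=
  (𝓝[<] quantile μ 1).comap Real.toEReal

/-- First order von Mises condition. In a left neighbourhood of the right endpoint `x*` the cdf `F`
is twice differentiable with positive density `f = F'`, and `((1 - F) / f)'(t)` has a finite limit
as `t ↑ x*`. Moreover there is no atom at `x*` (which is automatic if `F` has a density or is
differentiable everywhere, or if `x* = ∞`). -/
structure VonMises (μ : Measure ℝ) : Prop where
  smooth : ∀ᶠ t in leftOfEndpoint μ,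
    DifferentiableAt ℝ (cdf μ) t ∧ DifferentiableAt ℝ (deriv (cdf μ)) t ∧ 0 < deriv (cdf μ) t
  no_atom : Tendsto (cdf μ) (leftOfEndpoint μ) (𝓝 1)
  limit : ∃ γ : ℝ, Tendsto (deriv fun t => (1 - cdf μ t) / deriv (cdf μ) t)
    (leftOfEndpoint μ) (𝓝 γ)

/-- `U_F = (1 / (1 - F))⁻¹`, the generalized inverse of `1 / (1 - F)` (where `1 / 0 = ∞`). -/
def tailQuantile (μ : Measure ℝ) (t : ℝ) : ℝ :=
  sInf {x : ℝ | ENNReal.ofReal t ≤ (ENNReal.ofReal (1 - cdf μ x))⁻¹}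

/-- The scale `c_N = (N / k) U_F'(N / k)`. -/
def ivtScale (μ : Measure ℝ) (k : ℕ → ℕ) (N : ℕ) : ℝ :=
  (N / k N : ℝ) * deriv (tailQuantile μ) (N / k N : ℝ)

/-- The `j`-th smallest (`1 ≤ j ≤ N`) of the `N` numbers `x 0, …, x (N - 1)`: the least `t` such
that at least `j` of them are at most `t`. -/
def orderStat (x : ℕ → ℝ) (N j : ℕ) : ℝ :=
  sInf {t : ℝ | j ≤ ((Finset.range N).filter fun i => x i ≤ t).card}

/-- `sup_{u ∈ [0, s]} a (F⁻¹(1 - v - u) - F⁻¹(1 - v) + b G⁻¹(u))`. -/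
def supGap (F G : Measure ℝ) (a b s v : ℝ) : EReal :=
  ⨆ u ∈ Icc (0 : ℝ) s,
    (a : EReal) * (quantile F (1 - v - u) - quantile F (1 - v) + (b : EReal) * quantile G u)

/-- `inf_{u ∈ [0, s]} a (F⁻¹(1 - v + u) - F⁻¹(1 - v) + b G⁻¹(1 - u))`. -/
def infGap (F G : Measure ℝ) (a b s v : ℝ) : EReal :=
  ⨅ u ∈ Icc (0 : ℝ) s,
    (a : EReal) * (quantile F (1 - v + u) - quantile F (1 - v) + (b : EReal) * quantile G (1 - u))

/-- Convergence to `0` in probability of a family of extended-real random variables. -/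
def TendstoZeroInProb {Ω ι : Type*} [MeasurableSpace Ω] (P : Measure Ω) (l : Filter ι)
    (Z : ι → Ω → EReal) : Prop :=
  ∀ δ : ℝ, 0 < δ →
    Tendsto (fun i => P {ω | ¬ (((-δ : ℝ) : EReal) < Z i ω ∧ Z i ω < (δ : EReal))}) l (𝓝 0)

section Conditions

variable {Ω : Type*} [MeasurableSpace Ω] (P : Measure Ω) (U : ℕ → Ω → ℝ)
  (F : Measure ℝ) (G : ℕ → Measure ℝ) (p : ℝ) (k : ℕ → ℕ) (l : Filter (ℕ × ℕ))

/-- The supremum tail equivalence condition over `u ∈ [0, ε]`, at the random level `U_{k,N}`, along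
the filter `l` of pairs `(N, T)`. -/
def TESup (ε : ℝ) : Prop :=
  TendstoZeroInProb P l fun (n : ℕ × ℕ) ω =>
    supGap F (G n.2) (√(k n.1 : ℝ) / ivtScale F k n.1) (1 / (n.2 : ℝ) ^ p) ε
      (orderStat (fun i => U i ω) n.1 (k n.1))

/-- The supremum tail equivalence condition over the full range `u ∈ [0, 1 - U_{k,N}]`. -/
def TESupFull : Prop :=
  TendstoZeroInProb P l fun (n : ℕ × ℕ) ω =>
    supGap F (G n.2) (√(k n.1 : ℝ) / ivtScale F k n.1) (1 / (n.2 : ℝ) ^ p)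
      (1 - orderStat (fun i => U i ω) n.1 (k n.1)) (orderStat (fun i => U i ω) n.1 (k n.1))

/-- The infimum tail equivalence condition over `u ∈ [0, U_{k,N}]`. -/
def TEInf : Prop :=
  TendstoZeroInProb P l fun (n : ℕ × ℕ) ω =>
    infGap F (G n.2) (√(k n.1 : ℝ) / ivtScale F k n.1) (1 / (n.2 : ℝ) ^ p)
      (orderStat (fun i => U i ω) n.1 (k n.1)) (orderStat (fun i => U i ω) n.1 (k n.1))

end Conditions

/-- For each `T` the pairs `(θ_i, ε_{i,T})`, `i = 0, 1, …`, are iid with marginal laws `F` and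
`G T`; the dependence between `θ_i` and `ε_{i,T}` is unrestricted. -/
structure IsSample {Ω : Type*} [MeasurableSpace Ω] (P : Measure Ω) (θ : ℕ → Ω → ℝ)
    (ε : ℕ → ℕ → Ω → ℝ) (F : Measure ℝ) (G : ℕ → Measure ℝ) : Prop where
  indep : ∀ T, iIndepFun (fun i ω => (θ i ω, ε i T ω)) P
  ident : ∀ T i, IdentDistrib (fun ω => (θ i ω, ε i T ω)) (fun ω => (θ 0 ω, ε 0 T ω)) P P
  law_latent : ∀ i, HasLaw (θ i) F P
  law_noise : ∀ i T, HasLaw (ε i T) (G T) P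

/-- The normalized noisy intermediate order statistic
`√k (ϑ_{N-k,N,T} - F⁻¹(1 - k/N)) / c_N`, where `ϑ_{i,T} = θ_i + T^{-p} ε_{i,T}`. -/
def ivtStat {Ω : Type*} (θ : ℕ → Ω → ℝ) (ε : ℕ → ℕ → Ω → ℝ) (F : Measure ℝ) (p : ℝ)
    (k : ℕ → ℕ) (n : ℕ × ℕ) (ω : Ω) : ℝ :=
  √(k n.1 : ℝ) *
    ((orderStat (fun i => θ i ω + 1 / (n.2 : ℝ) ^ p * ε i n.2 ω) n.1 (n.1 - k n.1)
      - (quantile F (1 - (k n.1 : ℝ) / n.1)).toReal) / ivtScale F k n.1)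

end

noncomputable section

/-! Write `a = √k / c_N`, `Q(v) = F⁻¹(1 - v)`, and let `q(t)` be the probability that one noisy
observation exceeds `t`. The statistic is at most `y` exactly when at most `k` of the `N` noisy
observations exceed `t = Q(k/N) + y/a`. That number is binomial with parameters `N` and `q(t)`, so
it has the law of the number of uniforms below `q(t)` (`IsSample.real_ivtStat_le`), whatever the
dependence between signal and noise. The resulting probability decreases in `q(t)` and tends to
`Φ(-x)` when `q(t) = (k + x√k)/N` (`tendsto_real_hitCount`). Asymptotic normality therefore follows
once `q(t)` is squeezed between the levels with `x = -y ± 2η`, for every `η > 0`.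

Two facts supply the squeeze. The von Mises condition makes the tail quantile function locally
linear, so that `a (Q((k + x√k)/N) - Q(k/N)) → -x` (`VonMises.tendsto_upperQuantile`). Makarov's
inequalities bound the quantiles of a sum with given marginals: an infimum gap below `δ` at level
`v` gives `q(Q(v) + δ/a) ≤ v`, and a supremum gap above `δ` gives the reverse inequality. Since
`U_{k,N}` is asymptotically normal on the scale of these levels, a condition holding in probability
at `U_{k,N}` holds at some deterministic level in each window (`eventually_exists_level`).

For sharpness, Makarov's bounds are attained by driving signal and noise with one uniform and
reversing it on `[1 - v, 1]` or `[0, 1 - v]`. If a condition fails, levels with a large gap recur at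
bounded standardized distance. Choosing such a coupling separately for each `T` along a subsequence
shifts the noisy quantiles by a fixed standardized amount, which contradicts the normal limit
(`IsSample.false_of_shift`). -/

/-- The number of `i < N` with `X i ω ∈ A`, as a real number. -/
def hitCount {Ω β : Type*} (X : ℕ → Ω → β) (A : Set β) (N : ℕ) (ω : Ω) : ℝ :=
  ∑ i ∈ Finset.range N, A.indicator (1 : β → ℝ) (X i ω)

/-- The level `(k + x √k) / N`. -/
def lev (k : ℕ → ℕ) (x : ℝ) (N : ℕ) : ℝ := ((k N : ℝ) + x * √(k N : ℝ)) / N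

/-! ### Binomial counts and their characteristic functions. -/

section Counting

variable {Ω β : Type*} [MeasurableSpace Ω] [MeasurableSpace β] {P : Measure Ω}
  {X : ℕ → Ω → β} {A : Set β}

lemma hitCount_eq_card {Ω β : Type*} (X : ℕ → Ω → β) (A : Set β) (N : ℕ) (ω : Ω)
    [DecidablePred fun i => X i ω ∈ A] :
    hitCount X A N ω = (((Finset.range N).filter fun i => X i ω ∈ A).card : ℝ) := by
  classical
  rw [hitCount, Finset.card_filter, Nat.cast_sum]
  refine Finset.sum_congr rfl fun i _ => ?_
  by_cases h : X i ω ∈ A <;> simp [h]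

lemma aemeasurable_hitCount (hX : ∀ i, AEMeasurable (X i) P) (hA : MeasurableSet A) (N : ℕ) :
    AEMeasurable (hitCount X A N) P := by
  unfold hitCount
  refine Finset.aemeasurable_fun_sum _ fun i _ => ?_
  exact (measurable_one.indicator hA).comp_aemeasurable (hX i)

/-- The count is a sum of independent Bernoulli indicators, so its law sees the sample only through
`q` and `N`. -/
lemma charFun_hitCount [IsProbabilityMeasure P] (hX : ∀ i, AEMeasurable (X i) P)
    (hindep : iIndepFun X P) (hA : MeasurableSet A) {q : ℝ}
    (hq : ∀ i, P.real (X i ⁻¹' A) = q) (N : ℕ) (t : ℝ) :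
    charFun (P.map (hitCount X A N)) t
      = (1 + q * (Complex.exp (t * Complex.I) - 1)) ^ N := by
  have hm : Measurable (A.indicator (1 : β → ℝ)) := measurable_one.indicator hA
  have hi : iIndepFun (fun i ω => A.indicator (1 : β → ℝ) (X i ω)) P :=
    hindep.comp (fun _ => A.indicator (1 : β → ℝ)) (fun _ => hm)
  have key := (hi.restrict (Finset.range N)).charFun_map_fun_finsetSum_eq_prod
    (fun i _ => hm.comp_aemeasurable (hX i))
  have h2 : charFun (P.map (hitCount X A N))
      = ∏ i ∈ Finset.range N, charFun (P.map fun ω => A.indicator (1 : β → ℝ) (X i ω)) := key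
  rw [h2, Finset.prod_apply]
  rw [Finset.prod_eq_pow_card (b := 1 + q * (Complex.exp (t * Complex.I) - 1)), Finset.card_range]
  intro i _
  have hmi : AEMeasurable (fun ω => A.indicator (1 : β → ℝ) (X i ω)) P := hm.comp_aemeasurable (hX i)
  rw [charFun_apply_real, integral_map hmi (by fun_prop)]
  have hnull : NullMeasurableSet (X i ⁻¹' A) P := (hX i).nullMeasurable hA
  have : (fun ω => Complex.exp (t * (A.indicator (1 : β → ℝ) (X i ω) : ℝ) * Complex.I))
      = fun ω => 1 + (X i ⁻¹' A).indicator (fun _ => Complex.exp (t * Complex.I) - 1) ω := by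
    ext ω
    by_cases h : X i ω ∈ A
    · simp [Set.indicator, h]
    · simp [Set.indicator, h]
  rw [this, integral_add (integrable_const _), integral_indicator₀ hnull]
  · simp [hq i]
  · exact (integrable_const _).indicator₀ hnull

/-- This replaces exceedances by noisy observations with uniforms below a level of the same
probability. -/
lemma map_hitCount_eq [IsProbabilityMeasure P] (hX : ∀ i, AEMeasurable (X i) P)
    (hindep : iIndepFun X P) (hA : MeasurableSet A) {q : ℝ}
    (hq : ∀ i, P.real (X i ⁻¹' A) = q)
    {Ω' β' : Type*} [MeasurableSpace Ω'] [MeasurableSpace β'] {P' : Measure Ω'}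
    [IsProbabilityMeasure P'] {X' : ℕ → Ω' → β'} {A' : Set β'}
    (hX' : ∀ i, AEMeasurable (X' i) P')
    (hindep' : iIndepFun X' P') (hA' : MeasurableSet A')
    (hq' : ∀ i, P'.real (X' i ⁻¹' A') = q) (N : ℕ) :
    P.map (hitCount X A N) = P'.map (hitCount X' A' N) := by
  have := Measure.isProbabilityMeasure_map (aemeasurable_hitCount (A := A) hX hA N)
  have := Measure.isProbabilityMeasure_map (aemeasurable_hitCount (A := A') hX' hA' N)
  refine Measure.ext_of_charFun ?_
  ext t
  rw [charFun_hitCount hX hindep hA hq, charFun_hitCount hX' hindep' hA' hq']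

end Counting

lemma norm_pow_sub_pow_le_of_norm_le_one {z w : ℂ} (hz : ‖z‖ ≤ 1) (hw : ‖w‖ ≤ 1) (n : ℕ) :
    ‖z ^ n - w ^ n‖ ≤ n * ‖z - w‖ := by
  induction n with
  | zero => simp
  | succ n ih =>
    have : z ^ (n + 1) - w ^ (n + 1) = z * (z ^ n - w ^ n) + (z - w) * w ^ n := by ring
    rw [this]
    refine (norm_add_le _ _).trans ?_
    rw [norm_mul, norm_mul, norm_pow]
    have h1 : ‖z‖ * ‖z ^ n - w ^ n‖ ≤ 1 * (n * ‖z - w‖) := by gcongr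
    have h2 : ‖z - w‖ * ‖w‖ ^ n ≤ ‖z - w‖ * 1 := by
      gcongr
      exact pow_le_one₀ (norm_nonneg _) hw
    push_cast
    linarith

/-- The product `m (e^{i s / √k} - 1 - i s / √k)` with `m ~ k → ∞`. -/
lemma tendsto_mul_exp_sub_linear {ι : Type*} {l : Filter ι} {K m : ι → ℝ}
    (hK : Tendsto K l atTop) (hm : Tendsto (fun i => m i / K i) l (𝓝 1)) (s : ℝ) :
    Tendsto (fun i => (m i : ℂ) * (Complex.exp ((s / √(K i) : ℝ) * Complex.I) - 1
      - (s / √(K i) : ℝ) * Complex.I)) l (𝓝 (-(s : ℂ) ^ 2 / 2)) := by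
  have hsq : Tendsto (fun i => √(K i)) l atTop := Real.tendsto_sqrt_atTop.comp hK
  have hτ : Tendsto (fun i => s / √(K i)) l (𝓝 0) := hsq.const_div_atTop s
  have h1 : Tendsto (fun i => (m i : ℂ) * (Complex.exp ((s / √(K i) : ℝ) * Complex.I) - 1
      - (s / √(K i) : ℝ) * Complex.I) - ((m i / K i : ℝ) : ℂ) * (-(s : ℂ) ^ 2 / 2)) l (𝓝 0) := by
    rw [tendsto_zero_iff_norm_tendsto_zero]
    have hb : Tendsto (fun i => |m i / K i| * (s ^ 2 * |s / √(K i)|)) l (𝓝 0) := by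
      have := (hm.abs).mul ((hτ.abs).const_mul (s ^ 2))
      simpa using this
    refine squeeze_zero' (Eventually.of_forall fun _ => norm_nonneg _) ?_ hb
    filter_upwards [hK.eventually_gt_atTop 0, (hτ.abs).eventually_lt_const (by simp : |(0 : ℝ)| < 1)]
      with i hi h1i
    set τ := s / √(K i) with hτd
    have hτ2 : τ ^ 2 * K i = s ^ 2 := by
      rw [hτd, div_pow, Real.sq_sqrt hi.le]; field_simp
    have e : (m i : ℂ) * (Complex.exp ((τ : ℝ) * Complex.I) - 1 - (τ : ℝ) * Complex.I)
        - ((m i / K i : ℝ) : ℂ) * (-(s : ℂ) ^ 2 / 2)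
        = (m i : ℂ) * (Complex.exp ((τ : ℝ) * Complex.I)
          - ∑ j ∈ Finset.range 3, ((τ : ℝ) * Complex.I) ^ j / (j.factorial : ℂ)) := by
      have hKc : (K i : ℂ) ≠ 0 := by exact_mod_cast hi.ne'
      have : (s : ℂ) ^ 2 = (τ : ℂ) ^ 2 * K i := by exact_mod_cast hτ2.symm
      rw [this]
      push_cast
      simp only [Finset.sum_range_succ, Finset.sum_range_zero, Nat.factorial]
      have : ((τ : ℂ) * Complex.I) ^ 2 = - (τ : ℂ) ^ 2 := by
        rw [mul_pow, Complex.I_sq]; ring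
      simp only [this]
      push_cast
      field_simp
      ring
    rw [e, norm_mul]
    have hx : ‖((τ : ℝ) : ℂ) * Complex.I‖ = |τ| := by simp
    -- The quadratic Taylor term carries the limit; the cubic remainder times `K` is at most `s²
    -- |τ|`, which vanishes.
    have hb3 := Complex.exp_bound (x := ((τ : ℝ) : ℂ) * Complex.I) (by rw [hx]; exact h1i.le)
      (n := 3) (by norm_num)
    rw [hx] at hb3
    have h3 : |τ| ^ 3 * ((Nat.succ 3 : ℝ) * ((Nat.factorial 3 : ℝ) * (3 : ℕ))⁻¹) ≤ |τ| ^ 3 := by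
      have : ((Nat.succ 3 : ℝ) * ((Nat.factorial 3 : ℝ) * (3 : ℕ))⁻¹) ≤ 1 := by
        norm_num [Nat.factorial]
      exact mul_le_of_le_one_right (by positivity) this
    have hmn : ‖(m i : ℂ)‖ = |m i / K i| * K i := by
      rw [abs_div, abs_of_pos hi, Complex.norm_real, Real.norm_eq_abs]; field_simp
    rw [hmn]
    calc _ ≤ |m i / K i| * K i * |τ| ^ 3 := by
          gcongr
          exact hb3.trans h3
      _ = |m i / K i| * (s ^ 2 * |τ|) := by
          rw [← hτ2, ← sq_abs τ]; ring
  have h2 : Tendsto (fun i => ((m i / K i : ℝ) : ℂ) * (-(s : ℂ) ^ 2 / 2)) l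
      (𝓝 ((1 : ℝ) * (-(s : ℂ) ^ 2 / 2))) :=
    ((Complex.continuous_ofReal.tendsto 1).comp hm).mul_const _
  have := h1.add h2
  simpa using this

/-! ### Central limit theorem for uniforms at intermediate levels. -/

section Intermediate

variable {k : ℕ → ℕ} (hk : Tendsto k atTop atTop)
  (hkN : Tendsto (fun N : ℕ => (k N : ℝ) / N) atTop (𝓝 0))

include hk

lemma tendsto_sqrt_atTop_of_tendsto : Tendsto (fun N => √(k N : ℝ)) atTop atTop :=
  Real.tendsto_sqrt_atTop.comp (tendsto_natCast_atTop_atTop.comp hk)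

lemma tendsto_lev_mul_div (x : ℝ) :
    Tendsto (fun N => ((k N : ℝ) + x * √(k N : ℝ)) / k N) atTop (𝓝 1) := by
  have h := (tendsto_sqrt_atTop_of_tendsto hk).const_div_atTop x
  have h2 := h.const_add 1
  rw [add_zero] at h2
  refine h2.congr' ?_
  filter_upwards [hk.eventually_gt_atTop 0] with N hN
  have : (0 : ℝ) < k N := by exact_mod_cast hN
  have hs : 0 < √(k N : ℝ) := Real.sqrt_pos.2 this
  have h3 := Real.mul_self_sqrt this.le
  field_simp
  linear_combination (-x) * h3

include hkN

lemma tendsto_lev (x : ℝ) : Tendsto (lev k x) atTop (𝓝 0) := by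
  have := (tendsto_lev_mul_div hk x).mul hkN
  rw [mul_zero] at this
  refine this.congr' ?_
  filter_upwards [hk.eventually_gt_atTop 0] with N hN
  have : (0 : ℝ) < k N := by exact_mod_cast hN
  unfold lev
  field_simp

lemma eventually_lev_mem (x : ℝ) : ∀ᶠ N in atTop, lev k x N ∈ Ioo (0 : ℝ) 1 := by
  filter_upwards [(tendsto_lev hk hkN x).eventually_lt_const one_pos,
    (tendsto_lev_mul_div hk x).eventually_const_lt one_pos, hk.eventually_gt_atTop 0,
    eventually_gt_atTop 0] with N h1 h2 h3 h4
  have : (0 : ℝ) < k N := by exact_mod_cast h3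
  have h5 : (0 : ℝ) < N := by exact_mod_cast h4
  refine ⟨div_pos ?_ h5, h1⟩
  have := mul_pos h2 this
  field_simp at this
  linarith

omit hk hkN in
lemma real_uniform_preimage_Iic {Ω₀ : Type*} [MeasurableSpace Ω₀] {P₀ : Measure Ω₀} {V : Ω₀ → ℝ}
    (hV : HasLaw V (volume.restrict (Icc (0 : ℝ) 1)) P₀) {q : ℝ} (h0 : 0 ≤ q) (h1 : q ≤ 1) :
    P₀.real (V ⁻¹' Iic q) = q := by
  rw [← map_measureReal_apply_of_aemeasurable hV.aemeasurable measurableSet_Iic, hV.map_eq,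
    measureReal_restrict_apply measurableSet_Iic]
  have : Iic q ∩ Icc (0 : ℝ) 1 = Icc 0 q := by
    ext z; simp only [mem_inter_iff, mem_Iic, mem_Icc]; constructor
    · rintro ⟨a, b, c⟩; exact ⟨b, a⟩
    · rintro ⟨a, b⟩; exact ⟨b, a, b.trans h1⟩
  rw [this, Real.volume_real_Icc_of_le h0, sub_zero]

variable {Ω₀ : Type*} [MeasurableSpace Ω₀] {P₀ : Measure Ω₀} [IsProbabilityMeasure P₀]
    {U : ℕ → Ω₀ → ℝ} (hUindep : iIndepFun U P₀)
    (hUlaw : ∀ i, HasLaw (U i) (volume.restrict (Icc (0 : ℝ) 1)) P₀)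

include hUindep hUlaw

/-- Central limit theorem for the number of uniforms below `(k + x √k) / N`. -/
lemma tendsto_charFun_hitCount (x s : ℝ) :
    Tendsto (fun N => charFun (P₀.map fun ω => (√(k N : ℝ))⁻¹ * hitCount U (Iic (lev k x N)) N ω
      + -((√(k N : ℝ))⁻¹ * (k N + x * √(k N : ℝ)))) s) atTop
      (𝓝 (charFun (gaussianReal 0 1) s)) := by
  have hU := fun i => (hUlaw i).aemeasurable
  set w : ℕ → ℂ := fun N => lev k x N * (Complex.exp ((s / √(k N : ℝ) : ℝ) * Complex.I) - 1) with hw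
  set m : ℕ → ℝ := fun N => k N + x * √(k N : ℝ) with hm
  set τ : ℕ → ℝ := fun N => s / √(k N : ℝ) with hτd
  have hτ : Tendsto τ atTop (𝓝 0) := (tendsto_sqrt_atTop_of_tendsto hk).const_div_atTop s
  -- the characteristic function
  have hchar : ∀ᶠ N in atTop, charFun (P₀.map fun ω =>
      (√(k N : ℝ))⁻¹ * hitCount U (Iic (lev k x N)) N ω
      + -((√(k N : ℝ))⁻¹ * (k N + x * √(k N : ℝ)))) s
      = (1 + w N) ^ N * Complex.exp (-(m N * τ N : ℝ) * Complex.I) := by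
    filter_upwards [eventually_lev_mem hk hkN x] with N hN
    have hae := aemeasurable_hitCount (A := Iic (lev k x N)) hU measurableSet_Iic N
    have e1 : (P₀.map fun ω => (√(k N : ℝ))⁻¹ * hitCount U (Iic (lev k x N)) N ω
        + -((√(k N : ℝ))⁻¹ * (k N + x * √(k N : ℝ)))) =
        (P₀.map (fun ω => (√(k N : ℝ))⁻¹ * hitCount U (Iic (lev k x N)) N ω)).map
          (fun z => z + -((√(k N : ℝ))⁻¹ * (k N + x * √(k N : ℝ)))) := by
      rw [AEMeasurable.map_map_of_aemeasurable (by fun_prop) (hae.const_mul _)]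
      rfl
    rw [e1, charFun_map_add_const, charFun_map_mul_comp hae,
      charFun_hitCount hU hUindep measurableSet_Iic
        (fun i => real_uniform_preimage_Iic (hUlaw i) hN.1.le hN.2.le)]
    congr 1
    · simp only [hw]
      congr 5
      push_cast
      ring
    · congr 1
      simp only [hm, hτd, RCLike.inner_apply, conj_trivial]
      push_cast
      ring
  -- the limit of the exponential approximation
  have hlim1 : Tendsto (fun N => Complex.exp (N * w N) * Complex.exp (-(m N * τ N : ℝ) * Complex.I))
      atTop (𝓝 (Complex.exp (-(s : ℂ) ^ 2 / 2))) := by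
    have h := tendsto_mul_exp_sub_linear (K := fun N => (k N : ℝ)) (m := m)
      (tendsto_natCast_atTop_atTop.comp hk) (tendsto_lev_mul_div hk x) s
    refine ((Complex.continuous_exp.tendsto _).comp h).congr' ?_
    filter_upwards [eventually_gt_atTop 0] with N hN
    have hN' : (N : ℂ) ≠ 0 := by exact_mod_cast hN.ne'
    rw [← Complex.exp_add, Function.comp]
    congr 1
    simp only [hw, hm, hτd, lev]
    push_cast
    field_simp
    ring
  -- Both bases lie in the closed unit disc, so the `N`-th powers differ by at most `N |1 + w - e^w|
  -- ≤ N |w|²`, which is of order `k/N`.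
  have hlim2 : Tendsto (fun N => (1 + w N) ^ N - Complex.exp (N * w N)) atTop (𝓝 0) := by
    have hbd : Tendsto (fun N => 4 * (lev k x N) * (m N / k N) * s ^ 2) atTop (𝓝 0) := by
      have := (((tendsto_lev hk hkN x).const_mul 4).mul (tendsto_lev_mul_div hk x)).mul_const (s ^ 2)
      simpa using this
    rw [tendsto_zero_iff_norm_tendsto_zero]
    refine squeeze_zero' (Eventually.of_forall fun _ => norm_nonneg _) ?_ hbd
    filter_upwards [eventually_lev_mem hk hkN x, hk.eventually_gt_atTop 0, eventually_gt_atTop 0,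
      (hτ.abs).eventually_lt_const (by simp : |(0 : ℝ)| < 1 / 2)] with N hN hkp hNp hτN
    have hkp' : (0 : ℝ) < k N := by exact_mod_cast hkp
    have hNp' : (0 : ℝ) < N := by exact_mod_cast hNp
    have hE : ‖Complex.exp ((τ N : ℝ) * Complex.I)‖ = 1 := Complex.norm_exp_ofReal_mul_I _
    have hE1 : ‖Complex.exp ((τ N : ℝ) * Complex.I) - 1‖ ≤ 2 * |τ N| := by
      have := Complex.norm_exp_sub_one_le (x := (τ N : ℝ) * Complex.I)
        (by simp; linarith)
      simpa using this
    have hwn : ‖w N‖ ≤ lev k x N * (2 * |τ N|) := by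
      simp only [hw, norm_mul, Complex.norm_real, Real.norm_eq_abs, abs_of_pos hN.1]
      exact mul_le_mul_of_nonneg_left hE1 hN.1.le
    have hw1 : ‖w N‖ ≤ 1 := hwn.trans (by
      have : 2 * |τ N| ≤ 1 := by linarith
      exact mul_le_one₀ hN.2.le (by positivity) this)
    -- `1 + w` is a convex combination of `1` and a point of the unit circle.
    have hz : ‖1 + w N‖ ≤ 1 := by
      have : 1 + w N = ((1 - lev k x N : ℝ) : ℂ)
          + (lev k x N : ℝ) * Complex.exp ((τ N : ℝ) * Complex.I) := by
        simp only [hw, hτd]; push_cast; ring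
      rw [this]
      refine (norm_add_le _ _).trans ?_
      rw [norm_mul, hE, Complex.norm_real, Complex.norm_real, Real.norm_eq_abs, Real.norm_eq_abs,
        abs_of_pos hN.1, abs_of_pos (by linarith [hN.2])]
      linarith
    have hexp : ‖Complex.exp (w N)‖ ≤ 1 := by
      rw [Complex.norm_exp, Real.exp_le_one_iff]
      have : (w N).re = lev k x N * (Real.cos (τ N) - 1) := by
        simp only [hw, hτd]
        rw [Complex.re_ofReal_mul, Complex.sub_re, Complex.exp_ofReal_mul_I_re, Complex.one_re]
      rw [this]
      exact mul_nonpos_of_nonneg_of_nonpos hN.1.le (by linarith [Real.cos_le_one (τ N)])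
    have h1 := norm_pow_sub_pow_le_of_norm_le_one hz hexp N
    rw [← Complex.exp_nat_mul] at h1
    refine h1.trans ?_
    have h2 : ‖1 + w N - Complex.exp (w N)‖ ≤ ‖w N‖ ^ 2 := by
      have := Complex.norm_exp_sub_one_sub_id_le hw1
      rwa [← norm_neg, show -(1 + w N - Complex.exp (w N)) = Complex.exp (w N) - 1 - w N by ring]
    have h3 : ‖w N‖ ^ 2 ≤ (lev k x N * (2 * |τ N|)) ^ 2 := by gcongr
    calc (N : ℝ) * ‖1 + w N - Complex.exp (w N)‖ ≤ N * (lev k x N * (2 * |τ N|)) ^ 2 := by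
          gcongr; exact h2.trans h3
      _ = 4 * (lev k x N) * (m N / k N) * s ^ 2 := by
          rw [mul_pow, mul_pow, sq_abs]
          simp only [hτd, hm, lev, div_pow, Real.sq_sqrt hkp'.le]
          field_simp
          ring
  have hfin : Tendsto (fun N => (1 + w N) ^ N * Complex.exp (-(m N * τ N : ℝ) * Complex.I)) atTop
      (𝓝 (Complex.exp (-(s : ℂ) ^ 2 / 2))) := by
    have h0 : Tendsto (fun N => ((1 + w N) ^ N - Complex.exp (N * w N))
        * Complex.exp (-(m N * τ N : ℝ) * Complex.I)) atTop (𝓝 0) := by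
      rw [tendsto_zero_iff_norm_tendsto_zero] at hlim2 ⊢
      refine hlim2.congr fun N => ?_
      rw [norm_mul, ← Complex.ofReal_neg, Complex.norm_exp_ofReal_mul_I, mul_one]
    have := h0.add hlim1
    rw [zero_add] at this
    refine this.congr fun N => ?_
    ring
  have hg : charFun (gaussianReal 0 1) s = Complex.exp (-(s : ℂ) ^ 2 / 2) := by
    rw [charFun_gaussianReal]; congr 1; simp; ring
  rw [hg]
  exact hfin.congr' (hchar.mono fun N h => h.symm)

/-- The weak inequality serves the noisy order statistic, the strict one serves `U_{k,N}`; the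
limits agree because the Gaussian law has no atoms. -/
lemma tendsto_real_hitCount (x : ℝ) :
    Tendsto (fun N => P₀.real {ω | hitCount U (Iic (lev k x N)) N ω ≤ k N}) atTop
      (𝓝 (cdf (gaussianReal 0 1) (-x))) ∧
    Tendsto (fun N => P₀.real {ω | hitCount U (Iic (lev k x N)) N ω < k N}) atTop
      (𝓝 (cdf (gaussianReal 0 1) (-x))) := by
  have hU := fun i => (hUlaw i).aemeasurable
  have hae : ∀ N, AEMeasurable (fun ω => (√(k N : ℝ))⁻¹ * hitCount U (Iic (lev k x N)) N ω
      + -((√(k N : ℝ))⁻¹ * (k N + x * √(k N : ℝ)))) P₀ := fun N =>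
    ((aemeasurable_hitCount hU measurableSet_Iic N).const_mul _).add_const _
  let μs : ℕ → ProbabilityMeasure ℝ := fun N =>
    ⟨_, Measure.isProbabilityMeasure_map (hae N)⟩
  let ν : ProbabilityMeasure ℝ := ⟨gaussianReal 0 1, inferInstance⟩
  have hlim : Tendsto μs atTop (𝓝 ν) := ProbabilityMeasure.tendsto_of_tendsto_charFun
    fun s => tendsto_charFun_hitCount hk hkN hUindep hUlaw x s
  have hna : NullSingletonClass (gaussianReal 0 1) := nullSingletonClass_gaussianReal one_ne_zero
  have main : ∀ E : Set ℝ, MeasurableSet E → frontier E ⊆ {-x} →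
      Tendsto (fun N => P₀.real {ω | (√(k N : ℝ))⁻¹ * hitCount U (Iic (lev k x N)) N ω
      + -((√(k N : ℝ))⁻¹ * (k N + x * √(k N : ℝ))) ∈ E}) atTop
        (𝓝 ((gaussianReal 0 1).real E)) := by
    intro E hE hfr
    have h := ProbabilityMeasure.tendsto_measure_of_null_frontier_of_tendsto' hlim (E := E)
      (measure_mono_null hfr (measure_singleton (μ := gaussianReal 0 1) _))
    have h' := (ENNReal.tendsto_toReal (measure_ne_top _ _)).comp h
    refine h'.congr fun N => ?_
    simp only [Function.comp, μs, ProbabilityMeasure.coe_mk]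
    rw [Measure.map_apply_of_aemeasurable (hae N) hE]
    rfl
  have hIio : (gaussianReal 0 1).real (Iio (-x)) = cdf (gaussianReal 0 1) (-x) := by
    rw [cdf_eq_real]; exact measureReal_congr Iio_ae_eq_Iic
  constructor
  · have h := main (Iic (-x)) measurableSet_Iic (by rw [frontier_Iic])
    rw [← cdf_eq_real] at h
    refine h.congr' ?_
    filter_upwards [hk.eventually_gt_atTop 0] with N hN
    have hs : 0 < √(k N : ℝ) := Real.sqrt_pos.2 (by exact_mod_cast hN)
    congr 1
    ext ω
    simp only [mem_ofPred_eq, mem_Iic]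
    rw [← mul_le_mul_iff_right₀ hs]
    field_simp
    constructor <;> intro h <;> linarith
  · have h := main (Iio (-x)) measurableSet_Iio (by rw [frontier_Iio])
    rw [hIio] at h
    refine h.congr' ?_
    filter_upwards [hk.eventually_gt_atTop 0] with N hN
    have hs : 0 < √(k N : ℝ) := Real.sqrt_pos.2 (by exact_mod_cast hN)
    congr 1
    ext ω
    simp only [mem_ofPred_eq, mem_Iio]
    rw [← mul_lt_mul_iff_right₀ hs]
    field_simp
    constructor <;> intro h <;> linarith

end Intermediate

/-! ### Generalized inverses and the quantile transform. -/

section Quantile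

variable (μ : Measure ℝ)

lemma quantile_of_ne_zero {q : ℝ} (hq : q ≠ 0) :
    quantile μ q = sInf (Real.toEReal '' {x : ℝ | q ≤ cdf μ x}) := if_neg hq

lemma quantile_of_neg {q : ℝ} (hq : q < 0) : quantile μ q = ⊥ := by
  rw [quantile_of_ne_zero μ hq.ne, eq_bot_iff]
  refine EReal.le_of_forall_lt_iff_le.1 fun z _ => sInf_le ⟨z, ?_, rfl⟩
  exact hq.le.trans (cdf_nonneg μ z)

lemma monotone_quantile : Monotone (quantile μ) := by
  intro a b hab
  rcases hab.eq_or_lt with rfl | hlt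
  · exact le_rfl
  rcases lt_trichotomy a 0 with ha | rfl | ha
  · rw [quantile_of_neg μ ha]; exact bot_le
  · rw [quantile_of_ne_zero μ hlt.ne', quantile, if_pos rfl]
    exact sInf_le_sInf (image_mono fun x hx => lt_of_lt_of_le hlt hx)
  · rw [quantile_of_ne_zero μ ha.ne', quantile_of_ne_zero μ (ha.trans hlt).ne']
    exact sInf_le_sInf (image_mono fun x hx => le_trans hab hx)

/-- Right continuity of the cdf makes the infimum attained. Positivity of `q` matters, as level `0`
follows the left-endpoint convention. -/
lemma quantile_le_coe_iff {q : ℝ} (hq : 0 < q) (x : ℝ) :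
    quantile μ q ≤ (x : EReal) ↔ q ≤ cdf μ x := by
  rw [quantile_of_ne_zero μ hq.ne']
  constructor
  · intro h
    have hr : Tendsto (cdf μ) (𝓝[>] x) (𝓝 (cdf μ x)) :=
      ((cdf μ).right_continuous x).mono_left (nhdsWithin_mono _ Ioi_subset_Ici_self)
    refine ge_of_tendsto hr ?_
    filter_upwards [self_mem_nhdsWithin] with y hy
    have : sInf (Real.toEReal '' {x : ℝ | q ≤ cdf μ x}) < (y : EReal) :=
      lt_of_le_of_lt h (by exact_mod_cast hy)
    obtain ⟨_, ⟨z, hz, rfl⟩, hzy⟩ := sInf_lt_iff.1 this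
    exact le_trans hz (monotone_cdf μ (by exact_mod_cast hzy.le))
  · intro h
    exact sInf_le ⟨x, h, rfl⟩

lemma coe_lt_quantile_iff {q : ℝ} (hq : 0 < q) (x : ℝ) :
    (x : EReal) < quantile μ q ↔ cdf μ x < q := by
  rw [← not_le, quantile_le_coe_iff μ hq, not_le]

lemma quantile_ne_bot {q : ℝ} (hq : 0 < q) : quantile μ q ≠ ⊥ := by
  obtain ⟨x, hx⟩ := ((tendsto_cdf_atBot μ).eventually_lt_const hq).exists
  exact ne_bot_of_gt ((coe_lt_quantile_iff μ hq x).2 hx)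

lemma quantile_ne_top {q : ℝ} (hq : q < 1) : quantile μ q ≠ ⊤ := by
  rcases lt_or_ge 0 q with h0 | h0
  · obtain ⟨x, hx⟩ := ((tendsto_cdf_atTop μ).eventually_const_lt hq).exists
    exact ne_top_of_le_ne_top (EReal.coe_ne_top x) ((quantile_le_coe_iff μ h0 x).2 hx.le)
  · obtain ⟨x, hx⟩ := ((tendsto_cdf_atTop μ).eventually_const_lt
      (by norm_num : (1 / 2 : ℝ) < 1)).exists
    refine ne_top_of_le_ne_top (EReal.coe_ne_top x) ?_
    exact (monotone_quantile μ (h0.trans (by norm_num : (0 : ℝ) ≤ 1 / 2))).trans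
      ((quantile_le_coe_iff μ (by norm_num) x).2 hx.le)

lemma coe_toReal_quantile {q : ℝ} (h0 : 0 < q) (h1 : q < 1) :
    ((quantile μ q).toReal : EReal) = quantile μ q :=
  EReal.coe_toReal (quantile_ne_top μ h1) (quantile_ne_bot μ h0)

lemma toReal_quantile_le_iff {q : ℝ} (h0 : 0 < q) (h1 : q < 1) (x : ℝ) :
    (quantile μ q).toReal ≤ x ↔ q ≤ cdf μ x := by
  rw [← quantile_le_coe_iff μ h0, ← coe_toReal_quantile μ h0 h1, EReal.coe_le_coe_iff,
    coe_toReal_quantile μ h0 h1]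

lemma toReal_quantile_mono {a b : ℝ} (h0 : 0 < a) (hab : a ≤ b) (h1 : b < 1) :
    (quantile μ a).toReal ≤ (quantile μ b).toReal :=
  EReal.toReal_le_toReal (monotone_quantile μ hab) (quantile_ne_bot μ h0) (quantile_ne_top μ h1)

/-- The non-strict conclusion is what survives at `q = 0`, where the cdf vanishes below the left
endpoint. -/
lemma cdf_le_of_coe_lt_quantile {q : ℝ} (hq : 0 ≤ q) {x : ℝ} (hx : (x : EReal) < quantile μ q) :
    cdf μ x ≤ q := by
  rcases hq.eq_or_lt with rfl | hq
  · rw [quantile, if_pos rfl] at hx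
    by_contra h
    exact not_le.2 hx (sInf_le (mem_image_of_mem _ (not_le.1 h)))
  · exact ((coe_lt_quantile_iff μ hq x).1 hx).le

variable [IsProbabilityMeasure μ]

lemma real_coe_lt_quantile_le {q : ℝ} (hq : 0 ≤ q) :
    μ.real {x : ℝ | (x : EReal) < quantile μ q} ≤ q := by
  induction h : quantile μ q with
  | bot => simpa using hq
  | top =>
    have : 1 ≤ q := by
      by_contra h1
      exact quantile_ne_top μ (not_le.1 h1) h
    exact measureReal_le_one.trans this
  | coe r =>
    have e : {x : ℝ | (x : EReal) < (r : EReal)} = Iio r := by ext x; simp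
    have hle : Function.leftLim (cdf μ) r ≤ q := by
      refine le_of_tendsto ((monotone_cdf μ).tendsto_leftLim r) ?_
      filter_upwards [self_mem_nhdsWithin] with y hy
      refine cdf_le_of_coe_lt_quantile μ hq ?_
      rw [h]; exact_mod_cast hy
    rw [e, measureReal_def]
    conv_lhs => rw [← measure_cdf μ]
    rw [StieltjesFunction.measure_Iio _ (tendsto_cdf_atBot μ), sub_zero]
    exact ENNReal.toReal_le_of_le_ofReal hq (ENNReal.ofReal_le_ofReal hle)

lemma le_real_coe_le_quantile {q : ℝ} (hq : q ≤ 1) :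
    q ≤ μ.real {x : ℝ | (x : EReal) ≤ quantile μ q} := by
  rcases le_or_gt q 0 with h0 | h0
  · exact h0.trans measureReal_nonneg
  induction h : quantile μ q with
  | bot => exact absurd h (quantile_ne_bot μ h0)
  | top => simpa using hq
  | coe r =>
    have e : {x : ℝ | (x : EReal) ≤ (r : EReal)} = Iic r := by ext x; simp
    rw [e, ← cdf_eq_real]
    exact (quantile_le_coe_iff μ h0 r).1 h.le

omit [IsProbabilityMeasure μ] in
lemma measurable_toReal_quantile : Measurable fun q => (quantile μ q).toReal :=
  measurable_ereal_toReal.comp (monotone_quantile μ).measurable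

instance isProbabilityMeasure_uniform : IsProbabilityMeasure (volume.restrict (Icc (0 : ℝ) 1)) :=
  ⟨by simp⟩

/-- Quantile transform. -/
lemma map_quantile_uniform :
    (volume.restrict (Icc (0 : ℝ) 1)).map (fun q => (quantile μ q).toReal) = μ := by
  refine Measure.ext_of_Iic _ _ fun x => ?_
  rw [Measure.map_apply (measurable_toReal_quantile μ) measurableSet_Iic, ← ofReal_cdf,
    Measure.restrict_congr_set Ioo_ae_eq_Icc.symm,
    Measure.restrict_apply (measurable_toReal_quantile μ measurableSet_Iic)]
  -- The endpoints `0` and `1`, where the quantile may be infinite and `toReal` carries no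
  -- information, have been removed as a null set.
  have e : (fun q => (quantile μ q).toReal) ⁻¹' Iic x ∩ Ioo 0 1 = Ioc 0 (cdf μ x) ∩ Iio 1 := by
    ext q
    simp only [mem_inter_iff, mem_preimage, mem_Iic, mem_Ioo, mem_Ioc, mem_Iio]
    constructor
    · rintro ⟨h, h0, h1⟩
      exact ⟨⟨h0, (toReal_quantile_le_iff μ h0 h1 x).1 h⟩, h1⟩
    · rintro ⟨⟨h0, h⟩, h1⟩
      exact ⟨(toReal_quantile_le_iff μ h0 h1 x).2 h, h0, h1⟩
  have e2 : (Ioc 0 (cdf μ x) ∩ Iio 1 : Set ℝ) =ᵐ[volume] Ioc 0 (cdf μ x) := by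
    have : (Ioc 0 (cdf μ x) ∩ Iio 1 : Set ℝ) =ᵐ[volume] (Ioc 0 (cdf μ x) ∩ Iic 1 : Set ℝ) :=
      (ae_eq_refl _).inter Iio_ae_eq_Iic
    rwa [show Ioc 0 (cdf μ x) ∩ Iic 1 = Ioc 0 (cdf μ x) from
      inter_eq_left.2 fun z hz => hz.2.trans (cdf_le_one μ x)] at this
  rw [e, measure_congr e2, Real.volume_Ioc, sub_zero]

end Quantile

/-! ### Order statistics expressed through counts. -/

section OrderStat

lemma orderStat_le_iff {x : ℕ → ℝ} {N j : ℕ} (hj : 1 ≤ j) (hjN : j ≤ N) (t : ℝ) :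
    orderStat x N j ≤ t ↔ j ≤ ((Finset.range N).filter fun i => x i ≤ t).card := by
  set S : Set ℝ := {t : ℝ | j ≤ ((Finset.range N).filter fun i => x i ≤ t).card} with hS
  have hmono : ∀ a b, a ≤ b → a ∈ S → b ∈ S := fun a b hab ha => by
    refine le_trans (show j ≤ _ from ha) (Finset.card_le_card ?_)
    exact Finset.monotone_filter_right _ fun i _ hi => le_trans hi hab
  have hbdd : BddBelow S := by
    obtain ⟨m, hm⟩ := ((Finset.range N).image x).bddBelow
    refine ⟨m, fun t ht => ?_⟩
    have h1 : 0 < ((Finset.range N).filter fun i => x i ≤ t).card := lt_of_lt_of_le hj ht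
    obtain ⟨i, hi⟩ := Finset.card_pos.1 h1
    rw [Finset.mem_filter] at hi
    exact le_trans (hm (by exact Finset.mem_coe.2 (Finset.mem_image_of_mem x hi.1))) hi.2
  have hne : S.Nonempty := by
    obtain ⟨M, hM⟩ := ((Finset.range N).image x).bddAbove
    refine ⟨M, ?_⟩
    rw [hS, mem_ofPred_eq, Finset.filter_true_of_mem, Finset.card_range]
    · exact hjN
    · intro i hi
      exact hM (Finset.mem_coe.2 (Finset.mem_image_of_mem x hi))
  have hmem : sInf S ∈ S := by
    by_contra hnot
    -- Only finitely many values occur, so a point close enough to the infimum counts no value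
    -- beyond those counted at the infimum itself; hence the infimum is attained.
    have hev : ∀ᶠ t in 𝓝 (sInf S), ∀ i ∈ Finset.range N, sInf S < x i → t < x i := by
      rw [Filter.eventually_all_finset]
      intro i _
      by_cases h : sInf S < x i
      · exact (eventually_lt_nhds h).mono fun t ht _ => ht
      · exact Eventually.of_forall fun t h' => absurd h' h
    have hcl := csInf_mem_closure hne hbdd
    rw [mem_closure_iff_frequently] at hcl
    obtain ⟨t, htS, ht⟩ := (hcl.and_eventually hev).exists
    refine hnot (le_trans (show j ≤ _ from htS) (Finset.card_le_card ?_))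
    intro i hi
    rw [Finset.mem_filter] at hi ⊢
    refine ⟨hi.1, ?_⟩
    by_contra h
    exact absurd hi.2 (not_le.2 (ht i hi.1 (not_le.1 h)))
  constructor
  · intro h
    exact hmono _ _ h hmem
  · intro h
    exact csInf_le hbdd h

lemma measurable_orderStat (N j : ℕ) : Measurable fun x : ℕ → ℝ => orderStat x N j := by
  by_cases h : 1 ≤ j ∧ j ≤ N
  · refine measurable_of_Iic fun t => ?_
    have e : (fun x : ℕ → ℝ => orderStat x N j) ⁻¹' Iic t
        = {x | j ≤ ∑ i ∈ Finset.range N, if x i ≤ t then 1 else 0} := by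
      ext x
      rw [mem_preimage, mem_Iic, orderStat_le_iff h.1 h.2, Finset.card_filter]; rfl
    rw [e]
    refine measurableSet_le measurable_const ?_
    refine Finset.measurable_fun_sum _ fun i _ => ?_
    exact Measurable.ite (measurableSet_le (measurable_pi_apply i) measurable_const)
      measurable_const measurable_const
  -- For ranks outside `1, …, N` the defining set is empty or everything, independently of `x`.
  · have : ∃ S : Set ℝ, ∀ x : ℕ → ℝ,
        {t : ℝ | j ≤ ((Finset.range N).filter fun i => x i ≤ t).card} = S := by
      rcases Nat.lt_or_ge N j with h1 | h1
      · refine ⟨∅, fun x => ?_⟩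
        ext t
        simp only [mem_ofPred_eq, mem_empty_iff_false, iff_false, not_le]
        exact lt_of_le_of_lt (Finset.card_filter_le _ _) (by simpa using h1)
      · have h0 : j = 0 := by omega
        refine ⟨univ, fun x => ?_⟩
        ext t; simp [h0]
    obtain ⟨S, hS⟩ := this
    simp only [orderStat, hS]
    exact measurable_const

/-- `x_{(k)} ≤ v` iff not fewer than `k` of the values are at most `v`. -/
lemma orderStat_le_iff_hitCount {Ω : Type*} {X : ℕ → Ω → ℝ} {N j : ℕ} (hj : 1 ≤ j) (hjN : j ≤ N)
    (t : ℝ) (ω : Ω) :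
    orderStat (fun i => X i ω) N j ≤ t ↔ (j : ℝ) ≤ hitCount X (Iic t) N ω := by
  classical
  rw [orderStat_le_iff hj hjN, hitCount_eq_card X (Iic t) N ω, Nat.cast_le]
  rfl

/-- `x_{(N - k)} ≤ t` iff at most `k` of the values exceed `t`. -/
lemma orderStat_sub_le_iff_hitCount {Ω : Type*} {X : ℕ → Ω → ℝ} {N k : ℕ} (hk : k < N)
    (t : ℝ) (ω : Ω) :
    orderStat (fun i => X i ω) N (N - k) ≤ t ↔ hitCount X (Ioi t) N ω ≤ k := by
  classical
  rw [orderStat_le_iff (by omega) (by omega), hitCount_eq_card X (Ioi t) N ω, Nat.cast_le]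
  have h := Finset.card_filter_add_card_filter_not (s := Finset.range N) fun i => X i ω ≤ t
  have h2 : ((Finset.range N).filter fun i => X i ω ∈ Ioi t)
      = (Finset.range N).filter fun i => ¬ X i ω ≤ t := by
    refine Finset.filter_congr fun i _ => ?_
    simp
  rw [h2]
  rw [Finset.card_range] at h
  omega

end OrderStat

/-! ### Weak convergence on the line through distribution functions. -/

section Weak

variable {Ω ι : Type*} [MeasurableSpace Ω] {P : Measure Ω} [IsProbabilityMeasure P] {l : Filter ι}
  {X : ι → Ω → ℝ} {ν : Measure ℝ} [IsProbabilityMeasure ν]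

/-- Half-open intervals form a π-system containing arbitrarily small neighbourhoods of each point,
and their masses are differences of cdf values. -/
lemma tendstoInDistribution_of_tendsto_cdf [l.IsCountablyGenerated] (hX : ∀ i, AEMeasurable (X i) P)
    (h : ∀ y : ℝ, Tendsto (fun i => P.real {ω | X i ω ≤ y}) l (𝓝 (cdf ν y))) :
    TendstoInDistribution X l id (fun _ => P) ν where
  forall_aemeasurable := hX
  tendsto := by
    rw! [Measure.map_id]
    refine (isPiSystem_Ioc (id : ℝ → ℝ) (id : ℝ → ℝ)).tendsto_probabilityMeasure_of_tendsto_of_mem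
      ?_ ?_ ?_
    · rintro _ ⟨a, b, _, rfl⟩
      exact measurableSet_Ioc
    · intro u hu x hx
      obtain ⟨ε, hε, hb⟩ := Metric.isOpen_iff.1 hu x hx
      refine ⟨Ioc (x - ε / 2) (x + ε / 2), ⟨_, _, by simp; linarith, rfl⟩,
        Ioc_mem_nhds (by linarith) (by linarith), fun z hz => hb ?_⟩
      rw [Metric.mem_ball, Real.dist_eq, abs_lt]
      constructor <;> linarith [hz.1, hz.2]
    · rintro _ ⟨a, b, hab, rfl⟩
      simp only [id] at hab ⊢
      rw [← NNReal.tendsto_coe]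
      have key : ∀ μ : Measure ℝ, IsProbabilityMeasure μ →
          μ.real (Ioc a b) = μ.real (Iic b) - μ.real (Iic a) := by
        intro μ _
        rw [← measureReal_sdiff (Iic_subset_Iic.2 hab.le) measurableSet_Iic, Iic_sdiff_Iic]
      have h2 := (h b).sub (h a)
      rw [cdf_eq_real, cdf_eq_real, ← key ν inferInstance] at h2
      refine h2.congr fun i => ?_
      have hm := Measure.isProbabilityMeasure_map (hX i)
      have := key (P.map (X i)) hm
      rw [map_measureReal_apply_of_aemeasurable (hX i) measurableSet_Iic,
        map_measureReal_apply_of_aemeasurable (hX i) measurableSet_Iic] at this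
      exact this.symm

lemma tendsto_cdf_of_tendstoInDistribution [NullSingletonClass ν]
    (h : TendstoInDistribution X l id (fun _ => P) ν) (y : ℝ) :
    Tendsto (fun i => P.real {ω | X i ω ≤ y}) l (𝓝 (cdf ν y)) := by
  have h1 := ProbabilityMeasure.tendsto_measure_of_null_frontier_of_tendsto' h.tendsto
    (E := Iic y) (by simp)
  simp only [ProbabilityMeasure.coe_mk, Measure.map_id] at h1
  have h2 := (ENNReal.tendsto_toReal (measure_ne_top _ _)).comp h1
  rw [cdf_eq_real, measureReal_def]
  refine h2.congr fun i => ?_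
  simp only [Function.comp]
  rw [Measure.map_apply_of_aemeasurable (h.forall_aemeasurable i) measurableSet_Iic]
  rfl

lemma strictMono_cdf_gaussianReal : StrictMono (cdf (gaussianReal 0 1)) := by
  intro a b hab
  rw [cdf_eq_real, cdf_eq_real]
  have h : 0 < (gaussianReal 0 1).real (Ioc a b) := by
    rw [measureReal_def, ENNReal.toReal_pos_iff]
    refine ⟨?_, measure_lt_top _ _⟩
    rw [pos_iff_ne_zero]
    intro h0
    have := (gaussianReal_absolutelyContinuous' 0 one_ne_zero) h0
    rw [Real.volume_Ioc, ENNReal.ofReal_eq_zero] at this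
    linarith
  have := measureReal_sdiff (μ := gaussianReal 0 1) (Iic_subset_Iic.2 hab.le) measurableSet_Iic
  rw [Iic_sdiff_Iic] at this
  linarith

lemma continuous_cdf_of_noAtoms (ν : Measure ℝ) [IsProbabilityMeasure ν] [NullSingletonClass ν] :
    Continuous (cdf ν) := by
  rw [continuous_iff_continuousAt]
  intro x
  rw [(monotone_cdf ν).continuousAt_iff_leftLim_eq_rightLim, (cdf ν).rightLim_eq]
  have h : (cdf ν).measure {x} = 0 := by rw [measure_cdf]; simp
  rw [StieltjesFunction.measure_singleton, ENNReal.ofReal_eq_zero] at h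
  exact le_antisymm ((monotone_cdf ν).leftLim_le le_rfl) (by linarith)

end Weak

/-! ### The tail quantile function under the von Mises condition. -/

section VonMises

variable {F : Measure ℝ}

lemma tailQuantile_eq (F : Measure ℝ) {s : ℝ} (hs : 1 < s) :
    tailQuantile F s = (quantile F (1 - s⁻¹)).toReal := by
  have hs0 : 0 < s := one_pos.trans hs
  have hi : s⁻¹ < 1 := inv_lt_one_of_one_lt₀ hs
  have hi0 : 0 < s⁻¹ := inv_pos.2 hs0
  rw [tailQuantile]
  have : {x : ℝ | ENNReal.ofReal s ≤ (ENNReal.ofReal (1 - cdf F x))⁻¹}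
      = Ici (quantile F (1 - s⁻¹)).toReal := by
    ext x
    rw [mem_ofPred_eq, ENNReal.le_inv_iff_le_inv, ← ENNReal.ofReal_inv_of_pos hs0,
      ENNReal.ofReal_le_ofReal_iff hi0.le, mem_Ici,
      toReal_quantile_le_iff F (by linarith) (by linarith)]
    constructor <;> intro h <;> linarith
  rw [this, csInf_Ici]

lemma tailQuantile_le_iff (F : Measure ℝ) {s : ℝ} (hs : 1 < s) (x : ℝ) :
    tailQuantile F s ≤ x ↔ 1 - s⁻¹ ≤ cdf F x := by
  have hs0 : 0 < s := one_pos.trans hs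
  have hi : s⁻¹ < 1 := inv_lt_one_of_one_lt₀ hs
  have hi0 : 0 < s⁻¹ := inv_pos.2 hs0
  rw [tailQuantile_eq F hs, toReal_quantile_le_iff F (by linarith) (by linarith)]

lemma eventually_leftOfEndpoint_iff {p : ℝ → Prop} :
    (∀ᶠ t in leftOfEndpoint F, p t) ↔
      ∃ a : ℝ, cdf F a < 1 ∧ ∀ t, a < t → cdf F t < 1 → p t := by
  have hb : quantile F 1 ≠ ⊥ := quantile_ne_bot F one_pos
  have hlt : ∃ a, a < quantile F 1 := ⟨⊥, bot_lt_iff_ne_bot.2 hb⟩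
  unfold leftOfEndpoint
  rw [((nhdsLT_basis_of_exists_lt hlt).comap Real.toEReal).eventually_iff]
  constructor
  · rintro ⟨i, hi, h⟩
    obtain ⟨a, ha1, ha2⟩ := EReal.lt_iff_exists_real_btwn.1 hi
    refine ⟨a, (coe_lt_quantile_iff F one_pos a).1 ha2, fun t hat ht => h ?_⟩
    exact ⟨ha1.trans (by exact_mod_cast hat), (coe_lt_quantile_iff F one_pos t).2 ht⟩
  · rintro ⟨a, ha, h⟩
    refine ⟨a, (coe_lt_quantile_iff F one_pos a).2 ha, fun t ht => h t (by exact_mod_cast ht.1) ?_⟩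
    exact (coe_lt_quantile_iff F one_pos t).1 ht.2

instance leftOfEndpoint_neBot : (leftOfEndpoint F).NeBot := by
  rw [neBot_iff]
  intro h
  have : ∀ᶠ t in leftOfEndpoint F, False := by rw [h]; exact eventually_bot
  obtain ⟨a, ha, hfalse⟩ := eventually_leftOfEndpoint_iff.1 this
  have h2 := (coe_lt_quantile_iff F one_pos a).2 ha
  obtain ⟨b, hb1, hb2⟩ := EReal.lt_iff_exists_real_btwn.1 h2
  exact hfalse b (by exact_mod_cast hb1) ((coe_lt_quantile_iff F one_pos b).1 hb2)

/-- The reciprocal hazard rate `(1 - F) / f`. -/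
def mills (F : Measure ℝ) (t : ℝ) : ℝ := (1 - cdf F t) / deriv (cdf F) t

/-- `a` bounds a left neighbourhood of the endpoint on which the von Mises condition gives
regularity. -/
structure VonMisesOn (F : Measure ℝ) (a C : ℝ) : Prop where
  lt_one : cdf F a < 1
  nonneg : 0 ≤ C
  diff : ∀ t, a < t → cdf F t < 1 → DifferentiableAt ℝ (cdf F) t
  diff_deriv : ∀ t, a < t → cdf F t < 1 → DifferentiableAt ℝ (deriv (cdf F)) t
  deriv_pos : ∀ t, a < t → cdf F t < 1 → 0 < deriv (cdf F) t
  bound : ∀ t, a < t → cdf F t < 1 → |deriv (mills F) t| ≤ C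
  exists_gt : ∀ c < 1, ∃ t, a < t ∧ c < cdf F t ∧ cdf F t < 1

/-- Only boundedness of the derivative of the reciprocal hazard rate is kept from its convergence;
absence of an atom supplies cdf values below and arbitrarily near `1`. -/
lemma VonMises.exists_on (hF : VonMises F) : ∃ a C, VonMisesOn F a C := by
  obtain ⟨γ, hγ⟩ := hF.limit
  have hb : ∀ᶠ t in leftOfEndpoint F, |deriv (mills F) t| ≤ |γ| + 1 :=
    (hγ.abs.eventually_lt_const (by linarith : |γ| < |γ| + 1)).mono fun t ht => ht.le
  obtain ⟨a, ha, h⟩ := eventually_leftOfEndpoint_iff.1 (hF.smooth.and hb)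
  refine ⟨a, |γ| + 1, ha, by positivity, fun t h1 h2 => (h t h1 h2).1.1,
    fun t h1 h2 => (h t h1 h2).1.2.1, fun t h1 h2 => (h t h1 h2).1.2.2,
    fun t h1 h2 => (h t h1 h2).2, fun c hc => ?_⟩
  have h1 : ∀ᶠ t in leftOfEndpoint F, a < t ∧ cdf F t < 1 :=
    eventually_leftOfEndpoint_iff.2 ⟨a, ha, fun t h1 h2 => ⟨h1, h2⟩⟩
  obtain ⟨t, h2, h3⟩ := ((hF.no_atom.eventually_const_lt hc).and h1).exists
  exact ⟨t, h3.1, h2, h3.2⟩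

namespace VonMisesOn

variable {a C : ℝ}

lemma cdf_lt_cdf (h : VonMisesOn F a C) {x y : ℝ} (hx : a < x) (hxy : x < y)
    (hy : cdf F x < 1) : cdf F x < cdf F y := by
  rcases lt_or_ge (cdf F y) 1 with hy1 | hy1
  · have hlt : ∀ z ∈ Icc x y, a < z ∧ cdf F z < 1 := fun z hz =>
      ⟨hx.trans_le hz.1, (monotone_cdf F hz.2).trans_lt hy1⟩
    refine strictMonoOn_of_deriv_pos (convex_Icc x y) (fun z hz =>
      (h.diff z (hlt z hz).1 (hlt z hz).2).continuousAt.continuousWithinAt) (fun z hz => ?_)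
      (left_mem_Icc.2 hxy.le) (right_mem_Icc.2 hxy.le) hxy
    have := hlt z (interior_subset hz)
    exact h.deriv_pos z this.1 this.2
  · exact hy.trans_le hy1

/-- For levels beyond `1 / (1 - F a')` the tail quantile is an exact inverse. -/
lemma tailQuantile_spec (h : VonMisesOn F a C) {a' s : ℝ} (ha' : a < a') (h1 : cdf F a' < 1)
    (hs : (1 - cdf F a')⁻¹ < s) :
    a' < tailQuantile F s ∧ cdf F (tailQuantile F s) = 1 - s⁻¹ := by
  have hp : 0 < 1 - cdf F a' := by linarith
  have hp1 : 1 - cdf F a' ≤ 1 := by linarith [cdf_nonneg F a']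
  have hs1 : 1 < s := lt_of_le_of_lt (one_le_inv₀ hp |>.2 hp1) hs
  have hs0 : 0 < s := one_pos.trans hs1
  have hlt : cdf F a' < 1 - s⁻¹ := by
    have := (inv_lt_comm₀ hp hs0).1 hs
    linarith
  have hi0 : 0 < s⁻¹ := inv_pos.2 hs0
  have hgt : a' < tailQuantile F s := by
    rw [← not_le, tailQuantile_le_iff F hs1]
    exact not_le.2 hlt
  refine ⟨hgt, le_antisymm ?_ ((tailQuantile_le_iff F hs1 _).1 le_rfl)⟩
  -- A point with cdf value strictly between the target and `1` lets the intermediate value theorem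
  -- hit the target exactly.
  obtain ⟨t, hat, ht, ht1⟩ := h.exists_gt (1 - s⁻¹) (by linarith)
  have ha't : a' < t := (monotone_cdf F).reflect_lt (hlt.trans ht)
  have hcont : ContinuousOn (cdf F) (Icc a' t) := fun z hz =>
    (h.diff z (ha'.trans_le hz.1) ((monotone_cdf F hz.2).trans_lt ht1)).continuousAt.continuousWithinAt
  obtain ⟨u, hu, hFu⟩ := intermediate_value_Icc ha't.le hcont ⟨hlt.le, ht.le⟩
  have : tailQuantile F s ≤ u := (tailQuantile_le_iff F hs1 u).2 hFu.ge
  exact (monotone_cdf F this).trans hFu.le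

/-- A monotone function whose image contains a neighbourhood of its value is continuous; strict
growth of the cdf shows that nearby `u` is the image of `(1 - F u)⁻¹`. -/
lemma continuousAt_tailQuantile (h : VonMisesOn F a C) {a' s : ℝ} (ha' : a < a')
    (h1 : cdf F a' < 1) (hs : (1 - cdf F a')⁻¹ < s) : ContinuousAt (tailQuantile F) s := by
  have hp : 0 < 1 - cdf F a' := by linarith
  have hp1 : 1 - cdf F a' ≤ 1 := by linarith [cdf_nonneg F a']
  have hs1 : ∀ s, (1 - cdf F a')⁻¹ < s → 1 < s := fun s hs =>
    lt_of_le_of_lt (one_le_inv₀ hp |>.2 hp1) hs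
  have hspec := h.tailQuantile_spec ha' h1 hs
  have hs0 : 0 < s := one_pos.trans (hs1 s hs)
  have hlt : cdf F (tailQuantile F s) < 1 := by rw [hspec.2]; linarith [inv_pos.2 hs0]
  refine continuousAt_of_monotoneOn_of_image_mem_nhds (s := Ioi (1 - cdf F a')⁻¹) ?_
    (Ioi_mem_nhds hs) ?_
  · intro x hx y hy hxy
    rw [tailQuantile_le_iff F (hs1 x hx)]
    have := (tailQuantile_le_iff F (hs1 y hy) _).1 le_rfl
    have h2 : y⁻¹ ≤ x⁻¹ := inv_anti₀ (one_pos.trans (hs1 x hx)) hxy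
    linarith
  · have hc := (h.diff _ (ha'.trans hspec.1) hlt).continuousAt
    filter_upwards [eventually_gt_nhds hspec.1, hc.eventually_lt continuousAt_const hlt]
      with u hu hu1
    have hu2 := h.cdf_lt_cdf ha' hu h1
    have hpu : 0 < 1 - cdf F u := by linarith
    have hmem : (1 - cdf F a')⁻¹ < (1 - cdf F u)⁻¹ := inv_strictAnti₀ hpu (by linarith)
    refine ⟨(1 - cdf F u)⁻¹, hmem, ?_⟩
    have hsp := h.tailQuantile_spec ha' h1 hmem
    rw [inv_inv, sub_sub_cancel] at hsp
    rcases lt_trichotomy (tailQuantile F (1 - cdf F u)⁻¹) u with hl | he | hl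
    · exact absurd hsp.2 (h.cdf_lt_cdf (ha'.trans hsp.1) hl (by linarith [hsp.2])).ne
    · exact he
    · exact absurd hsp.2 (h.cdf_lt_cdf (ha'.trans hu) hl hu1).ne'

/-- Differentiate the inverse of `1/(1 - F)`, using `1 - F = 1/s` at the tail quantile. -/
lemma hasDerivAt_tailQuantile (h : VonMisesOn F a C) {a' s : ℝ} (ha' : a < a')
    (h1 : cdf F a' < 1) (hs : (1 - cdf F a')⁻¹ < s) :
    HasDerivAt (tailQuantile F) (mills F (tailQuantile F s) / s) s := by
  have hp : 0 < 1 - cdf F a' := by linarith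
  have hs0 : 0 < s := (inv_pos.2 hp).trans hs
  have hspec := h.tailQuantile_spec ha' h1 hs
  have hlt : cdf F (tailQuantile F s) < 1 := by rw [hspec.2]; linarith [inv_pos.2 hs0]
  have hd := (h.diff _ (ha'.trans hspec.1) hlt).hasDerivAt
  have hpos := h.deriv_pos _ (ha'.trans hspec.1) hlt
  have hd2 := (hd.const_sub 1).fun_inv (by linarith)
  have := HasDerivAt.of_local_left_inverse (h.continuousAt_tailQuantile ha' h1 hs) hd2
    (by rw [neg_neg]; have : 0 < 1 - cdf F (tailQuantile F s) := by linarith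
        positivity)
    (by
      filter_upwards [eventually_gt_nhds hs] with y hy
      rw [(h.tailQuantile_spec ha' h1 hy).2, sub_sub_cancel, inv_inv])
  refine this.congr_deriv ?_
  have hF1 : 1 - cdf F (tailQuantile F s) = s⁻¹ := by rw [hspec.2]; ring
  unfold mills
  rw [hF1]
  field_simp

lemma mills_pos (h : VonMisesOn F a C) {t : ℝ} (ht : a < t) (h1 : cdf F t < 1) : 0 < mills F t :=
  div_pos (by linarith) (h.deriv_pos t ht h1)

/-- This is where the second derivative of `F` enters: the logarithmic derivative of `U_F'` is
`O(1/s)`, so `U_F'` is nearly constant on small relative neighbourhoods. -/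
lemma hasDerivAt_log_deriv (h : VonMisesOn F a C) {a' s : ℝ} (ha' : a < a')
    (h1 : cdf F a' < 1) (hs : (1 - cdf F a')⁻¹ < s) :
    HasDerivAt (fun s => Real.log (deriv (tailQuantile F) s))
      ((deriv (mills F) (tailQuantile F s) - 1) / s) s := by
  have hp : 0 < 1 - cdf F a' := by linarith
  have hs0 : 0 < s := (inv_pos.2 hp).trans hs
  have hspec := h.tailQuantile_spec ha' h1 hs
  have hlt : cdf F (tailQuantile F s) < 1 := by rw [hspec.2]; linarith [inv_pos.2 hs0]
  have haQ := ha'.trans hspec.1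
  have hmp := h.mills_pos haQ hlt
  have hm : HasDerivAt (mills F) (deriv (mills F) (tailQuantile F s)) (tailQuantile F s) := by
    apply DifferentiableAt.hasDerivAt
    exact ((h.diff _ haQ hlt).const_sub 1).fun_div (h.diff_deriv _ haQ hlt)
      (h.deriv_pos _ haQ hlt).ne'
  have hcomp := hm.comp s (h.hasDerivAt_tailQuantile ha' h1 hs)
  have hdiv := (hcomp.fun_div (hasDerivAt_id s) hs0.ne')
  have hlog := hdiv.log (div_pos hmp hs0).ne'
  have heq : (fun s => Real.log (deriv (tailQuantile F) s)) =ᶠ[𝓝 s]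
      fun s => Real.log ((mills F ∘ tailQuantile F) s / id s) := by
    filter_upwards [eventually_gt_nhds hs] with y hy
    rw [(h.hasDerivAt_tailQuantile ha' h1 hy).deriv]; rfl
  refine (hlog.congr_of_eventuallyEq heq).congr_deriv ?_
  simp only [Function.comp, id]
  field_simp

end VonMisesOn

lemma VonMises.eventually_deriv_pos (hF : VonMises F) :
    ∀ᶠ r in atTop, 0 < deriv (tailQuantile F) r := by
  obtain ⟨a, C, h⟩ := hF.exists_on
  obtain ⟨a', ha', -, h1⟩ := h.exists_gt 0 one_pos
  have hp : 0 < 1 - cdf F a' := by linarith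
  filter_upwards [eventually_gt_atTop (1 - cdf F a')⁻¹] with s hs
  rw [(h.hasDerivAt_tailQuantile ha' h1 hs).deriv]
  have hs0 : 0 < s := (inv_pos.2 hp).trans hs
  have hspec := h.tailQuantile_spec ha' h1 hs
  have hlt : cdf F (tailQuantile F s) < 1 := by rw [hspec.2]; linarith [inv_pos.2 hs0]
  exact div_pos (h.mills_pos (ha'.trans hspec.1) hlt) hs0

/-- Local linearity of `U_F` at infinity, uniformly in a small relative neighbourhood. -/
lemma VonMises.tailQuantile_linear (hF : VonMises F) {η : ℝ} (hη : 0 < η) :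
    ∃ d > 0, ∀ᶠ r in atTop, ∀ s, |s - r| ≤ d * r →
      |tailQuantile F s - tailQuantile F r - deriv (tailQuantile F) r * (s - r)|
        ≤ η * deriv (tailQuantile F) r * |s - r| := by
  obtain ⟨a, C, h⟩ := hF.exists_on
  obtain ⟨a', ha', -, h1⟩ := h.exists_gt 0 one_pos
  have hp : 0 < 1 - cdf F a' := by linarith
  have hC := h.nonneg
  -- The three bounds keep the interval above `r/2`, make the oscillation of `log U_F'` at most `1`
  -- (so that `|e^x - 1| ≤ 2|x|` applies), and make the relative oscillation of `U_F'` at most `η`.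
  set d := min (1 / 2) (min (1 / (2 * (C + 1))) (η / (4 * (C + 1)))) with hd
  have hd0 : 0 < d := by positivity
  have hd1 : d ≤ 1 / 2 := min_le_left _ _
  have hd2 : 2 * (C + 1) * d ≤ 1 := by
    have : d ≤ 1 / (2 * (C + 1)) := (min_le_right _ _).trans (min_le_left _ _)
    rw [le_div_iff₀ (by positivity)] at this; linarith
  have hd3 : 2 * (2 * (C + 1) * d) ≤ η := by
    have : d ≤ η / (4 * (C + 1)) := (min_le_right _ _).trans (min_le_right _ _)
    rw [le_div_iff₀ (by positivity)] at this; linarith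
  refine ⟨d, hd0, ?_⟩
  have hR : 0 < (1 - cdf F a')⁻¹ := inv_pos.2 hp
  have hderpos : ∀ s, (1 - cdf F a')⁻¹ < s → 0 < deriv (tailQuantile F) s := by
    intro s hs
    rw [(h.hasDerivAt_tailQuantile ha' h1 hs).deriv]
    have hs0 : 0 < s := hR.trans hs
    have hspec := h.tailQuantile_spec ha' h1 hs
    have hlt : cdf F (tailQuantile F s) < 1 := by rw [hspec.2]; linarith [inv_pos.2 hs0]
    exact div_pos (h.mills_pos (ha'.trans hspec.1) hlt) hs0
  filter_upwards [eventually_gt_atTop (2 * (1 - cdf F a')⁻¹)] with r hr s hs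
  have hr0 : 0 < r := by linarith
  set J := Icc (r - d * r) (r + d * r) with hJ
  have hdr : d * r ≤ 1 / 2 * r := by gcongr
  have hdr0 : 0 < d * r := by positivity
  have hJlt : ∀ z ∈ J, (1 - cdf F a')⁻¹ < z := fun z hz => by
    have := hz.1; linarith
  have hJhalf : ∀ z ∈ J, r / 2 ≤ z := fun z hz => by
    have := hz.1; linarith
  have hrJ : r ∈ J := ⟨by linarith, by linarith⟩
  have hsJ : s ∈ J := by
    rw [abs_le] at hs
    exact ⟨by linarith, by linarith⟩
  have hlogb : ∀ z ∈ J, |Real.log (deriv (tailQuantile F) z) - Real.log (deriv (tailQuantile F) r)|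
      ≤ 2 * (C + 1) * d := by
    intro z hz
    have := (convex_Icc (r - d * r) (r + d * r)).norm_image_sub_le_of_norm_hasDerivWithin_le
      (f := fun s => Real.log (deriv (tailQuantile F) s)) (C := 2 * (C + 1) / r)
      (fun y hy => (h.hasDerivAt_log_deriv ha' h1 (hJlt y hy)).hasDerivWithinAt)
      (fun y hy => by
        have hy0 : 0 < y := hR.trans (hJlt y hy)
        have hspec := h.tailQuantile_spec ha' h1 (hJlt y hy)
        have hlt : cdf F (tailQuantile F y) < 1 := by rw [hspec.2]; linarith [inv_pos.2 hy0]
        have hb := h.bound _ (ha'.trans hspec.1) hlt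
        rw [Real.norm_eq_abs, abs_div, abs_of_pos hy0, div_le_div_iff₀ hy0 hr0]
        have h3 : |deriv (mills F) (tailQuantile F y) - 1| ≤ C + 1 := by
          refine (abs_sub _ _).trans ?_
          simpa using hb
        have h4 := hJhalf y hy
        calc _ ≤ (C + 1) * r := by gcongr
          _ ≤ (C + 1) * (2 * y) := by gcongr; linarith
          _ = _ := by ring) hrJ hz
    rw [Real.norm_eq_abs, Real.norm_eq_abs] at this
    refine this.trans ?_
    have hz2 : |z - r| ≤ d * r := abs_le.2 ⟨by linarith [hz.1], by linarith [hz.2]⟩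
    calc _ ≤ 2 * (C + 1) / r * (d * r) := by gcongr
      _ = _ := by field_simp
  have hderb : ∀ z ∈ J, |deriv (tailQuantile F) z - deriv (tailQuantile F) r|
      ≤ η * deriv (tailQuantile F) r := by
    intro z hz
    have hz0 := hderpos z (hJlt z hz)
    have hr1 := hderpos r (hJlt r hrJ)
    set e := Real.log (deriv (tailQuantile F) z) - Real.log (deriv (tailQuantile F) r) with he
    have hexp : deriv (tailQuantile F) z = deriv (tailQuantile F) r * Real.exp e := by
      rw [he, Real.exp_sub, Real.exp_log hz0, Real.exp_log hr1]; field_simp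
    have heb := hlogb z hz
    have h5 := Real.abs_exp_sub_one_le (x := e) (heb.trans hd2)
    rw [hexp, show deriv (tailQuantile F) r * Real.exp e - deriv (tailQuantile F) r
      = deriv (tailQuantile F) r * (Real.exp e - 1) by ring, abs_mul, abs_of_pos hr1, mul_comm]
    gcongr
    linarith
  -- The mean value inequality is applied after subtracting the linear part with slope `U_F'(r)`.
  have := (convex_Icc (r - d * r) (r + d * r)).norm_image_sub_le_of_norm_hasDerivWithin_le
      (f := fun s => tailQuantile F s - deriv (tailQuantile F) r * s)
      (f' := fun s => deriv (tailQuantile F) s - deriv (tailQuantile F) r * 1)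
      (C := η * deriv (tailQuantile F) r)
      (fun y hy => (HasDerivAt.fun_sub
        (h.hasDerivAt_tailQuantile ha' h1 (hJlt y hy)).differentiableAt.hasDerivAt
        ((hasDerivAt_id y).const_mul _)).hasDerivWithinAt)
      (fun y hy => by rw [mul_one]; exact hderb y hy) hrJ hsJ
  rw [Real.norm_eq_abs, Real.norm_eq_abs] at this
  refine le_trans (le_of_eq ?_) this
  congr 1
  ring

variable {k : ℕ → ℕ}

/-- The real quantile `F⁻¹(1 - v)`. -/
def upperQuantile (F : Measure ℝ) (v : ℝ) : ℝ := (quantile F (1 - v)).toReal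

lemma tendsto_div_atTop (hk : Tendsto k atTop atTop)
    (hkN : Tendsto (fun N : ℕ => (k N : ℝ) / N) atTop (𝓝 0)) :
    Tendsto (fun N : ℕ => (N / k N : ℝ)) atTop atTop := by
  have h : ∀ᶠ N : ℕ in atTop, (k N : ℝ) / N ∈ Ioi 0 := by
    filter_upwards [hk.eventually_gt_atTop 0, eventually_gt_atTop 0] with N h1 h2
    have h1' : (0 : ℝ) < k N := by exact_mod_cast h1
    have h2' : (0 : ℝ) < N := by exact_mod_cast h2
    exact div_pos h1' h2'
  have := (tendsto_nhdsWithin_iff.2 ⟨hkN, h⟩).inv_tendsto_nhdsGT_zero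
  refine this.congr fun N => ?_
  simp

lemma VonMises.eventually_ivtScale_pos (hF : VonMises F) (hk : Tendsto k atTop atTop)
    (hkN : Tendsto (fun N : ℕ => (k N : ℝ) / N) atTop (𝓝 0)) :
    ∀ᶠ N in atTop, 0 < ivtScale F k N := by
  have h := tendsto_div_atTop hk hkN
  filter_upwards [h.eventually hF.eventually_deriv_pos, h.eventually_gt_atTop 0] with N h1 h2
  exact mul_pos h2 h1

/-- Limit of the quantiles at the intermediate levels. -/
lemma VonMises.tendsto_upperQuantile (hF : VonMises F) (hk : Tendsto k atTop atTop)
    (hkN : Tendsto (fun N : ℕ => (k N : ℝ) / N) atTop (𝓝 0)) (x : ℝ) :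
    Tendsto (fun N => √(k N : ℝ) / ivtScale F k N *
      (upperQuantile F (lev k x N) - upperQuantile F ((k N : ℝ) / N))) atTop (𝓝 (-x)) := by
  have hr := tendsto_div_atTop hk hkN
  have hev := eventually_lev_mem hk hkN x
  set r : ℕ → ℝ := fun N => (N / k N : ℝ) with hrd
  set s : ℕ → ℝ := fun N => (lev k x N)⁻¹ with hsd
  -- the relative increment
  have hinc : Tendsto (fun N => √(k N : ℝ) * ((s N - r N) / r N)) atTop (𝓝 (-x)) := by
    have h1 := (tendsto_lev_mul_div hk x).inv₀ one_ne_zero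
    have h2 := h1.const_mul (-x)
    rw [inv_one, mul_one] at h2
    refine h2.congr' ?_
    filter_upwards [hk.eventually_gt_atTop 0, eventually_gt_atTop 0, hev] with N hN hN0 hl
    have hkp : (0 : ℝ) < k N := by exact_mod_cast hN
    have hNp : (0 : ℝ) < N := by exact_mod_cast hN0
    have hm : (0 : ℝ) < k N + x * √(k N : ℝ) := by
      have := mul_pos hl.1 hNp
      rwa [lev, div_mul_cancel₀ _ hNp.ne'] at this
    have hs := Real.mul_self_sqrt hkp.le
    simp only [hsd, hrd, lev, inv_div]
    field_simp
    linear_combination x * hs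
  have hrel : Tendsto (fun N => (s N - r N) / r N) atTop (𝓝 0) := by
    have h1 := hinc.mul ((tendsto_sqrt_atTop_of_tendsto hk).inv_tendsto_atTop)
    rw [mul_zero] at h1
    refine h1.congr' ?_
    filter_upwards [hk.eventually_gt_atTop 0] with N hN
    have hs : 0 < √(k N : ℝ) := Real.sqrt_pos.2 (by exact_mod_cast hN)
    simp only [Pi.inv_apply]
    field_simp
  have hdiff : Tendsto (fun N => √(k N : ℝ) / ivtScale F k N *
      (upperQuantile F (lev k x N) - upperQuantile F ((k N : ℝ) / N))
      - √(k N : ℝ) * ((s N - r N) / r N)) atTop (𝓝 0) := by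
    rw [Metric.tendsto_nhds]
    intro η hη
    -- The scaled increment is eventually below `|x| + 1` in absolute value, so this tolerance
    -- yields a total error below `η`.
    obtain ⟨d, hd, hlin⟩ := hF.tailQuantile_linear (η := η / (|x| + 1)) (by positivity)
    have hb : ∀ᶠ N in atTop, |√(k N : ℝ) * ((s N - r N) / r N)| < |x| + 1 :=
      (hinc.abs).eventually_lt_const (by rw [abs_neg]; linarith)
    filter_upwards [hr.eventually hlin, hr.eventually hF.eventually_deriv_pos, hb,
      (hrel.abs).eventually_lt_const (by simpa using hd), hr.eventually_gt_atTop 1,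
      hev, hk.eventually_gt_atTop 0] with N hlinN hpos hbN hrelN hr1 hl hN
    have hr0 : 0 < r N := one_pos.trans hr1
    have hs : 0 < √(k N : ℝ) := Real.sqrt_pos.2 (by exact_mod_cast hN)
    have hs1 : 1 < s N := (one_lt_inv₀ hl.1).2 hl.2
    have hsr : |s N - r N| ≤ d * r N := by
      rw [abs_div, abs_of_pos hr0, div_lt_iff₀ hr0] at hrelN
      exact hrelN.le
    have e1 : upperQuantile F (lev k x N) = tailQuantile F (s N) := by
      rw [tailQuantile_eq F hs1, upperQuantile, hsd, inv_inv]
    have e2 : upperQuantile F ((k N : ℝ) / N) = tailQuantile F (r N) := by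
      rw [tailQuantile_eq F hr1, upperQuantile, hrd, inv_div]
    have e3 : ivtScale F k N = r N * deriv (tailQuantile F) (r N) := rfl
    rw [Real.dist_eq, sub_zero, e1, e2, e3]
    have h3 := hlinN (s N) hsr
    set D := deriv (tailQuantile F) (r N)
    have e4 : √(k N : ℝ) / (r N * D) * (tailQuantile F (s N) - tailQuantile F (r N))
        - √(k N : ℝ) * ((s N - r N) / r N) = √(k N : ℝ) / (r N * D) *
          (tailQuantile F (s N) - tailQuantile F (r N) - D * (s N - r N)) := by
      field_simp
    rw [e4, abs_mul, abs_of_pos (by positivity)]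
    calc _ ≤ √(k N : ℝ) / (r N * D) * (η / (|x| + 1) * D * |s N - r N|) := by gcongr
      _ = η / (|x| + 1) * |√(k N : ℝ) * ((s N - r N) / r N)| := by
          rw [abs_mul, abs_div, abs_of_pos hr0, abs_of_pos hs]; field_simp
      _ < η / (|x| + 1) * (|x| + 1) := by gcongr
      _ = η := by field_simp
  have := hdiff.add hinc
  simpa using this

end VonMises

/-! ### Makarov's bounds and the ordering of the gaps. -/

section Makarov

variable {Ω : Type*} [MeasurableSpace Ω] {P : Measure Ω} {F G : Measure ℝ} {X Y : Ω → ℝ}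

lemma measurableSet_coe_lt_of_ereal (z : EReal) : MeasurableSet {x : ℝ | (x : EReal) < z} :=
  measurable_coe_real_ereal measurableSet_Iio

lemma measurableSet_lt_coe_of_ereal (z : EReal) : MeasurableSet {x : ℝ | z < (x : EReal)} :=
  measurable_coe_real_ereal measurableSet_Ioi

lemma real_quantile_lt_coe_le (μ : Measure ℝ) [IsProbabilityMeasure μ] {q : ℝ} (hq : q ≤ 1) :
    μ.real {x : ℝ | quantile μ q < (x : EReal)} ≤ 1 - q := by
  have h := le_real_coe_le_quantile μ hq
  have h2 := probReal_compl_eq_one_sub (μ := μ) (measurableSet_lt_coe_of_ereal (quantile μ q))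
  have e : {x : ℝ | quantile μ q < (x : EReal)}ᶜ = {x : ℝ | (x : EReal) ≤ quantile μ q} := by
    ext x; simp
  rw [e] at h2
  linarith

lemma coe_gap (a b c x y : ℝ) :
    (a : EReal) * ((x : EReal) - (c : EReal) + (b : EReal) * (y : EReal))
      = ((a * (x - c + b * y) : ℝ) : EReal) := by
  push_cast; rfl

lemma gap_mono {a b : ℝ} (ha : 0 ≤ a) (hb : 0 ≤ b) (c : EReal) {x x' y y' : EReal} (hx : x ≤ x')
    (hy : y ≤ y') :
    (a : EReal) * (x - c + (b : EReal) * y) ≤ (a : EReal) * (x' - c + (b : EReal) * y') := by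
  have ha' : (0 : EReal) ≤ a := by exact_mod_cast ha
  have hb' : (0 : EReal) ≤ b := by exact_mod_cast hb
  exact mul_le_mul_of_nonneg_left
    (add_le_add (EReal.sub_le_sub hx le_rfl) (mul_le_mul_of_nonneg_left hy hb')) ha'

variable [IsProbabilityMeasure F] [IsProbabilityMeasure G]

/-- Makarov's upper bound for the quantiles of a sum. -/
lemma real_lt_add_le_of_infGap_lt (hX : HasLaw X F P) (hY : HasLaw Y G P) {a b v δ : ℝ}
    (ha : 0 < a) (hb : 0 ≤ b) (hv0 : 0 < v) (hv1 : v < 1) (h : infGap F G a b v v < (δ : EReal)) :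
    P.real {ω | upperQuantile F v + δ / a < X ω + b * Y ω} ≤ v := by
  have hPF := hX.isFiniteMeasure
  obtain ⟨u, hu⟩ := iInf_lt_iff.1 h
  obtain ⟨hu2, hlt⟩ := iInf_lt_iff.1 hu
  have hc : quantile F (1 - v) = (upperQuantile F v : EReal) :=
    (coe_toReal_quantile F (by linarith) (by linarith)).symm
  rw [hc] at hlt
  -- If neither summand exceeds its quantile at a near-optimal `u`, the sum stays below the
  -- threshold. The exceptional probabilities `v - u` and `u` add up to `v`.
  have hsub : {ω | upperQuantile F v + δ / a < X ω + b * Y ω} ⊆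
      {ω | quantile F (1 - v + u) < (X ω : EReal)} ∪ {ω | quantile G (1 - u) < (Y ω : EReal)} := by
    intro ω hω
    by_contra hnot
    simp only [mem_union, mem_ofPred_eq, not_or, not_lt] at hnot hω
    have h1 := (gap_mono ha.le hb (upperQuantile F v : EReal) hnot.1 hnot.2).trans_lt hlt
    rw [coe_gap, EReal.coe_lt_coe_iff] at h1
    rw [← lt_div_iff₀' ha] at h1
    linarith
  have h1 := hX.measureReal_eq (measurableSet_lt_coe_of_ereal (quantile F (1 - v + u)))
  have h2 := hY.measureReal_eq (measurableSet_lt_coe_of_ereal (quantile G (1 - u)))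
  have h3 := real_quantile_lt_coe_le F (q := 1 - v + u) (by linarith [hu2.2])
  have h4 := real_quantile_lt_coe_le G (q := 1 - u) (by linarith [hu2.1])
  calc _ ≤ _ := measureReal_mono hsub
    _ ≤ _ := measureReal_union_le _ _
    _ ≤ v := by rw [h1, h2]; linarith

/-- Makarov's lower bound for the quantiles of a sum. -/
lemma real_add_le_le_of_lt_supGap (hX : HasLaw X F P) (hY : HasLaw Y G P) {a b v δ : ℝ}
    (ha : 0 < a) (hb : 0 ≤ b) (hv0 : 0 < v) (hv1 : v < 1)
    (h : (δ : EReal) < supGap F G a b (1 - v) v) :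
    P.real {ω | X ω + b * Y ω ≤ upperQuantile F v + δ / a} ≤ 1 - v := by
  have hPF := hX.isFiniteMeasure
  obtain ⟨u, hu⟩ := lt_iSup_iff.1 h
  obtain ⟨hu2, hlt⟩ := lt_iSup_iff.1 hu
  have hc : quantile F (1 - v) = (upperQuantile F v : EReal) :=
    (coe_toReal_quantile F (by linarith) (by linarith)).symm
  rw [hc] at hlt
  have hsub : {ω | X ω + b * Y ω ≤ upperQuantile F v + δ / a} ⊆
      {ω | (X ω : EReal) < quantile F (1 - v - u)} ∪ {ω | (Y ω : EReal) < quantile G u} := by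
    intro ω hω
    by_contra hnot
    simp only [mem_union, mem_ofPred_eq, not_or, not_lt] at hnot hω
    have h1 := hlt.trans_le (gap_mono ha.le hb (upperQuantile F v : EReal) hnot.1 hnot.2)
    rw [coe_gap, EReal.coe_lt_coe_iff] at h1
    rw [← div_lt_iff₀' ha] at h1
    linarith
  have h1 := hX.measureReal_eq (measurableSet_coe_lt_of_ereal (quantile F (1 - v - u)))
  have h2 := hY.measureReal_eq (measurableSet_coe_lt_of_ereal (quantile G u))
  have h3 := real_coe_lt_quantile_le F (q := 1 - v - u) (by linarith [hu2.2])
  have h4 := real_coe_lt_quantile_le G (q := u) hu2.1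
  calc _ ≤ _ := measureReal_mono hsub
    _ ≤ _ := measureReal_union_le _ _
    _ ≤ 1 - v := by rw [h1, h2]; linarith

omit [IsProbabilityMeasure F] [IsProbabilityMeasure G]

lemma supGap_le_supGap_full {a : ℝ} (ha : 0 < a) (b s v : ℝ) :
    supGap F G a b s v ≤ supGap F G a b (1 - v) v := by
  refine iSup₂_le fun u hu => ?_
  rcases le_or_gt u (1 - v) with h | h
  · exact le_iSup₂_of_le u ⟨hu.1, h⟩ le_rfl
  -- Beyond `1 - v` the first quantile is `-∞`, which absorbs the noise term even when that is `+∞`;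
  -- such `u` do not affect the supremum.
  · rw [quantile_of_neg F (by linarith : 1 - v - u < 0), sub_eq_add_neg, EReal.bot_add,
      EReal.bot_add, EReal.coe_mul_bot_of_pos ha]
    exact bot_le

/-- Every term of the supremum is below every term of the infimum: `1 - v - u ≤ 1 - v + w`, and `u ≤
1 - v ≤ 1 - w`. -/
lemma supGap_full_le_infGap {a b : ℝ} (ha : 0 ≤ a) (hb : 0 ≤ b) (v : ℝ) :
    supGap F G a b (1 - v) v ≤ infGap F G a b v v := by
  refine iSup₂_le fun u hu => le_iInf₂ fun w hw => ?_
  exact gap_mono ha hb _ (monotone_quantile F (by linarith [hu.1, hw.1]))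
    (monotone_quantile G (by linarith [hu.2, hw.2]))

end Makarov

/-! ### Reduction to binomial probabilities and deterministic levels. -/

section Sample

variable {Ω : Type*} [MeasurableSpace Ω] {P : Measure Ω} [IsProbabilityMeasure P]
  {θ : ℕ → Ω → ℝ} {ε : ℕ → ℕ → Ω → ℝ} {F : Measure ℝ} {G : ℕ → Measure ℝ} {p : ℝ} {k : ℕ → ℕ}

/-- The probability that a noisy observation exceeds `t`. -/
def exceedProb (P : Measure Ω) (θ : ℕ → Ω → ℝ) (ε : ℕ → ℕ → Ω → ℝ) (p : ℝ) (T : ℕ) (t : ℝ) : ℝ :=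
  P.real {ω | t < θ 0 ω + 1 / (T : ℝ) ^ p * ε 0 T ω}

omit [IsProbabilityMeasure P] in
lemma IsSample.aemeasurable_noisy (h : IsSample P θ ε F G) (b : ℝ) (T i : ℕ) :
    AEMeasurable (fun ω => θ i ω + b * ε i T ω) P :=
  (h.law_latent i).aemeasurable.add ((h.law_noise i T).aemeasurable.const_mul _)

omit [IsProbabilityMeasure P] in
lemma IsSample.aemeasurable_ivtStat (h : IsSample P θ ε F G) (n : ℕ × ℕ) :
    AEMeasurable (ivtStat θ ε F p k n) P := by
  unfold ivtStat
  refine AEMeasurable.const_mul (AEMeasurable.div_const (AEMeasurable.sub_const ?_ _) _) _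
  exact (measurable_orderStat n.1 (n.1 - k n.1)).comp_aemeasurable
    (aemeasurable_pi_iff.2 fun i => h.aemeasurable_noisy _ n.2 i)

lemma exceedProb_antitone (T : ℕ) : Antitone (exceedProb P θ ε p T) := fun _ _ hst =>
  measureReal_mono fun _ hω => lt_of_le_of_lt hst hω

omit [IsProbabilityMeasure P] in
lemma IsSample.real_Ioi (h : IsSample P θ ε F G) (T i : ℕ) (t : ℝ) :
    P.real ((fun ω => θ i ω + 1 / (T : ℝ) ^ p * ε i T ω) ⁻¹' Ioi t) = exceedProb P θ ε p T t := by
  have hm : Measurable fun z : ℝ × ℝ => z.1 + 1 / (T : ℝ) ^ p * z.2 := by fun_prop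
  have := ((h.ident T i).comp hm).measure_preimage_eq (measurableSet_Ioi (a := t))
  rw [measureReal_def, exceedProb, measureReal_def]
  exact congrArg ENNReal.toReal this

variable {Ω₀ : Type*} [MeasurableSpace Ω₀] {P₀ : Measure Ω₀} [IsProbabilityMeasure P₀]
    {U : ℕ → Ω₀ → ℝ}

lemma real_hitCount_antitone (N : ℕ) (m : ℝ) :
    Antitone fun q => P₀.real {ω | hitCount U (Iic q) N ω ≤ m} := by
  intro q q' hq
  refine measureReal_mono fun ω hω => ?_
  refine le_trans (b := hitCount U (Iic q') N ω) ?_ hω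
  refine Finset.sum_le_sum fun i _ => ?_
  exact indicator_le_indicator_of_subset (Iic_subset_Iic.2 hq) (fun _ => zero_le_one) _

variable (hUindep : iIndepFun U P₀)
    (hUlaw : ∀ i, HasLaw (U i) (volume.restrict (Icc (0 : ℝ) 1)) P₀)

include hUindep hUlaw

/-- All dependence on the coupling is condensed in one exceedance probability, read as a level for a
uniform sample. -/
lemma IsSample.real_ivtStat_le (h : IsSample P θ ε F G) {n : ℕ × ℕ} (hk : 0 < k n.1)
    (hkN : k n.1 < n.1) (hc : 0 < ivtScale F k n.1) (y : ℝ) :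
    P.real {ω | ivtStat θ ε F p k n ω ≤ y} = P₀.real {ω | hitCount U
      (Iic (exceedProb P θ ε p n.2 (upperQuantile F ((k n.1 : ℝ) / n.1)
        + y / (√(k n.1 : ℝ) / ivtScale F k n.1)))) n.1 ω ≤ k n.1} := by
  set ϑ : ℕ → Ω → ℝ := fun i ω => θ i ω + 1 / (n.2 : ℝ) ^ p * ε i n.2 ω with hϑ
  set t := upperQuantile F ((k n.1 : ℝ) / n.1) + y / (√(k n.1 : ℝ) / ivtScale F k n.1) with ht
  have hs : 0 < √(k n.1 : ℝ) := Real.sqrt_pos.2 (by exact_mod_cast hk)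
  have e : {ω | ivtStat θ ε F p k n ω ≤ y} = hitCount ϑ (Ioi t) n.1 ⁻¹' Iic (k n.1 : ℝ) := by
    ext ω
    rw [mem_preimage, mem_Iic, ← orderStat_sub_le_iff_hitCount hkN, mem_ofPred_eq, ivtStat, ht,
      ← sub_le_iff_le_add', ← mul_div_assoc, mul_div_right_comm, le_div_iff₀' (by positivity)]
    rfl
  have hae : ∀ i, AEMeasurable (ϑ i) P := fun i => h.aemeasurable_noisy _ n.2 i
  have hindep : iIndepFun ϑ P := by
    have hm : Measurable fun z : ℝ × ℝ => z.1 + 1 / (n.2 : ℝ) ^ p * z.2 := by fun_prop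
    exact (h.indep n.2).comp (fun _ z => z.1 + 1 / (n.2 : ℝ) ^ p * z.2) (fun _ => hm)
  have hU := fun i => (hUlaw i).aemeasurable
  have hmap := map_hitCount_eq hae hindep (measurableSet_Ioi (a := t))
    (fun i => h.real_Ioi (p := p) n.2 i t) hU hUindep
    (measurableSet_Iic (a := exceedProb P θ ε p n.2 t))
    (fun i => real_uniform_preimage_Iic (hUlaw i) measureReal_nonneg measureReal_le_one) n.1
  rw [e, ← map_measureReal_apply_of_aemeasurable (aemeasurable_hitCount hae measurableSet_Ioi _)
    measurableSet_Iic, hmap, map_measureReal_apply_of_aemeasurable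
    (aemeasurable_hitCount hU measurableSet_Iic _) measurableSet_Iic]
  rfl

variable (hk : Tendsto k atTop atTop)
  (hkN : Tendsto (fun N : ℕ => (k N : ℝ) / N) atTop (𝓝 0))

include hk hkN

omit hUindep hUlaw in
lemma eventually_lt_of_tendsto_div : ∀ᶠ N in atTop, 0 < k N ∧ k N < N := by
  filter_upwards [hkN.eventually_lt_const one_pos, eventually_gt_atTop 0, hk.eventually_gt_atTop 0]
    with N h1 h2 h3
  have h2' : (0 : ℝ) < N := by exact_mod_cast h2
  rw [div_lt_one h2'] at h1
  exact ⟨h3, by exact_mod_cast h1⟩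

/-- Limit law of the intermediate uniform order statistic. -/
lemma tendsto_real_orderStat_le (x : ℝ) :
    Tendsto (fun N => P₀.real {ω | orderStat (fun i => U i ω) N (k N) ≤ lev k x N}) atTop
      (𝓝 (1 - cdf (gaussianReal 0 1) (-x))) := by
  have h := (tendsto_real_hitCount hk hkN hUindep hUlaw x).2.const_sub 1
  refine h.congr' ?_
  filter_upwards [eventually_lt_of_tendsto_div hk hkN] with N hN
  have hae := aemeasurable_hitCount (A := Iic (lev k x N)) (fun i => (hUlaw i).aemeasurable)
    measurableSet_Iic N
  refine (probReal_compl_eq_one_sub₀ (s := {ω | hitCount U (Iic (lev k x N)) N ω < k N})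
    (hae.nullMeasurable measurableSet_Iio)).symm.trans ?_
  congr 1
  ext ω
  simp only [mem_compl_iff, mem_ofPred_eq, not_lt]
  exact (orderStat_le_iff_hitCount hN.1 hN.2.le _ ω).symm

/-- Events of vanishing probability cannot exhaust an interval of levels for `U_{k,N}`. -/
lemma eventually_exists_level {l : Filter (ℕ × ℕ)} (hlN : Tendsto Prod.fst l atTop)
    {bad : ℕ × ℕ → ℝ → Prop}
    (hbad : Tendsto (fun n : ℕ × ℕ => P₀ {ω | bad n (orderStat (fun i => U i ω) n.1 (k n.1))}) l
      (𝓝 0)) {x x' : ℝ} (hx : x < x') :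
    ∀ᶠ n in l, ∃ v, lev k x n.1 < v ∧ v ≤ lev k x' n.1 ∧ ¬ bad n v := by
  have h1 := (tendsto_real_orderStat_le hUindep hUlaw hk hkN x').sub
    (tendsto_real_orderStat_le hUindep hUlaw hk hkN x)
  have hpos : 0 < (1 - cdf (gaussianReal 0 1) (-x')) - (1 - cdf (gaussianReal 0 1) (-x)) := by
    have := strictMono_cdf_gaussianReal (neg_lt_neg hx)
    linarith
  have h2 := (ENNReal.tendsto_toReal ENNReal.zero_ne_top).comp hbad
  have h3 := (h1.comp hlN).sub h2
  rw [ENNReal.toReal_zero, sub_zero] at h3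
  filter_upwards [h3.eventually_const_lt hpos] with n hn
  by_contra hcon
  push Not at hcon
  simp only [Function.comp, ← measureReal_def] at hn
  -- Only monotonicity and subadditivity are used, so the bad event need not be measurable.
  have hsub : {ω | orderStat (fun i => U i ω) n.1 (k n.1) ≤ lev k x' n.1} ⊆
      {ω | orderStat (fun i => U i ω) n.1 (k n.1) ≤ lev k x n.1} ∪
      {ω | bad n (orderStat (fun i => U i ω) n.1 (k n.1))} := by
    intro ω hω
    by_cases hle : orderStat (fun i => U i ω) n.1 (k n.1) ≤ lev k x n.1
    · exact Or.inl hle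
    · exact Or.inr (hcon _ (not_le.1 hle) hω)
  have := (measureReal_mono (μ := P₀) hsub).trans (measureReal_union_le _ _)
  linarith

end Sample

/-! ### Transferral of convergence. -/

section Transfer

variable {F : Measure ℝ} {G : ℕ → Measure ℝ} {p : ℝ} {k : ℕ → ℕ} {l : Filter (ℕ × ℕ)}
  {Ω₀ : Type*} [MeasurableSpace Ω₀] {P₀ : Measure Ω₀} {U : ℕ → Ω₀ → ℝ}

lemma one_div_rpow_nonneg (T : ℕ) (p : ℝ) : 0 ≤ 1 / (T : ℝ) ^ p :=
  div_nonneg zero_le_one (Real.rpow_nonneg (Nat.cast_nonneg T) p)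

lemma VonMises.eventually_scale_pos (hF : VonMises F) (hk : Tendsto k atTop atTop)
    (hkN : Tendsto (fun N : ℕ => (k N : ℝ) / N) atTop (𝓝 0)) :
    ∀ᶠ N in atTop, 0 < √(k N : ℝ) / ivtScale F k N := by
  filter_upwards [hF.eventually_ivtScale_pos hk hkN, hk.eventually_gt_atTop 0] with N h1 h2
  exact div_pos (Real.sqrt_pos.2 (by exact_mod_cast h2)) h1

/-- The full-range supremum lies between the restricted supremum and the infimum gap, both of which
tend to zero in probability. -/
lemma TESup.full (hF : VonMises F) (hk : Tendsto k atTop atTop)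
    (hkN : Tendsto (fun N : ℕ => (k N : ℝ) / N) atTop (𝓝 0))
    (hlN : Tendsto Prod.fst l atTop) {s : ℝ} (hs : TESup P₀ U F G p k l s)
    (hi : TEInf P₀ U F G p k l) : TESupFull P₀ U F G p k l := by
  intro δ hδ
  have h := (hs δ hδ).add (hi δ hδ)
  rw [add_zero] at h
  refine tendsto_of_tendsto_of_tendsto_of_le_of_le' tendsto_const_nhds h
    (Eventually.of_forall fun _ => zero_le) ?_
  filter_upwards [hlN.eventually (hF.eventually_scale_pos hk hkN)] with n hn
  refine (measure_mono fun ω hω => ?_).trans (measure_union_le _ _)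
  by_contra hnot
  simp only [mem_union, mem_ofPred_eq, not_or, not_not] at hnot hω
  exact hω ⟨hnot.1.1.trans_le (supGap_le_supGap_full hn _ _ _),
    (supGap_full_le_infGap hn.le (one_div_rpow_nonneg _ _) _).trans_lt hnot.2.2⟩

lemma antitoneOn_upperQuantile (F : Measure ℝ) {v w : ℝ} (hv : 0 < v) (hvw : v ≤ w) (hw : w < 1) :
    upperQuantile F w ≤ upperQuantile F v :=
  toReal_quantile_mono F (by linarith) (by linarith) (by linarith)

variable [IsProbabilityMeasure P₀] [IsProbabilityMeasure F] [∀ T, IsProbabilityMeasure (G T)]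
  {Ω : Type*} [MeasurableSpace Ω] {P : Measure Ω} [IsProbabilityMeasure P]
  {θ : ℕ → Ω → ℝ} {ε : ℕ → ℕ → Ω → ℝ}

omit [IsProbabilityMeasure P] in
lemma IsSample.exceedProb_le (h : IsSample P θ ε F G) {T : ℕ} {a v δ : ℝ}
    (ha : 0 < a) (hv0 : 0 < v) (hv1 : v < 1)
    (hgap : infGap F (G T) a (1 / (T : ℝ) ^ p) v v < (δ : EReal)) :
    exceedProb P θ ε p T (upperQuantile F v + δ / a) ≤ v :=
  real_lt_add_le_of_infGap_lt (h.law_latent 0) (h.law_noise 0 T) ha (one_div_rpow_nonneg _ _)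
    hv0 hv1 hgap

lemma IsSample.le_exceedProb (h : IsSample P θ ε F G) {T : ℕ} {a v δ : ℝ}
    (ha : 0 < a) (hv0 : 0 < v) (hv1 : v < 1)
    (hgap : (δ : EReal) < supGap F (G T) a (1 / (T : ℝ) ^ p) (1 - v) v) :
    v ≤ exceedProb P θ ε p T (upperQuantile F v + δ / a) := by
  have h1 := real_add_le_le_of_lt_supGap (h.law_latent 0) (h.law_noise 0 T) ha
    (one_div_rpow_nonneg T p) hv0 hv1 hgap
  have hn : NullMeasurableSet {ω | upperQuantile F v + δ / a <
      θ 0 ω + 1 / (T : ℝ) ^ p * ε 0 T ω} P :=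
    (h.aemeasurable_noisy _ T 0).nullMeasurable measurableSet_Ioi
  have h2 := probReal_compl_eq_one_sub₀ hn
  have e : {ω | upperQuantile F v + δ / a < θ 0 ω + 1 / (T : ℝ) ^ p * ε 0 T ω}ᶜ
      = {ω | θ 0 ω + 1 / (T : ℝ) ^ p * ε 0 T ω ≤ upperQuantile F v + δ / a} := by
    ext ω; simp
  rw [e] at h2
  unfold exceedProb
  linarith

variable (hF : VonMises F) (hk : Tendsto k atTop atTop)
  (hkN : Tendsto (fun N : ℕ => (k N : ℝ) / N) atTop (𝓝 0))
  (hlN : Tendsto Prod.fst l atTop) (hUindep : iIndepFun U P₀)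
  (hUlaw : ∀ i, HasLaw (U i) (volume.restrict (Icc (0 : ℝ) 1)) P₀)

include hF hk hkN hlN hUindep hUlaw

/-- Good deterministic levels exist in windows of width `η` around `-y`. Makarov's bounds at these
levels, shifted by at most `η/2`, still leave room because the quantile at `-y ± η` is about `∓η`
away on the standardized scale. Only the upper half of the infimum condition and the lower half of
the supremum condition are needed. -/
lemma IsSample.eventually_exceedProb_mem (h : IsSample P θ ε F G)
    (hs : TESupFull P₀ U F G p k l) (hi : TEInf P₀ U F G p k l) (y : ℝ) {η : ℝ} (hη : 0 < η) :
    ∀ᶠ n in l, exceedProb P θ ε p n.2 (upperQuantile F ((k n.1 : ℝ) / n.1)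
        + y / (√(k n.1 : ℝ) / ivtScale F k n.1))
      ∈ Icc (lev k (-y - 2 * η) n.1) (lev k (-y + 2 * η) n.1) := by
  have hlev := fun x => hlN.eventually (eventually_lev_mem hk hkN x)
  have hq1 := (hF.tendsto_upperQuantile hk hkN (-y + η)).comp hlN
  have hq2 := (hF.tendsto_upperQuantile hk hkN (-y - η)).comp hlN
  have hb1 := eventually_exists_level hUindep hUlaw hk hkN hlN (hi (η / 2) (half_pos hη))
    (x := -y + η) (x' := -y + 2 * η) (by linarith)
    (bad := fun n v => ¬ (((-(η / 2) : ℝ) : EReal) <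
      infGap F (G n.2) (√(k n.1 : ℝ) / ivtScale F k n.1) (1 / (n.2 : ℝ) ^ p) v v ∧
      infGap F (G n.2) (√(k n.1 : ℝ) / ivtScale F k n.1) (1 / (n.2 : ℝ) ^ p) v v
        < ((η / 2 : ℝ) : EReal)))
  have hb2 := eventually_exists_level hUindep hUlaw hk hkN hlN (hs (η / 2) (half_pos hη))
    (x := -y - 2 * η) (x' := -y - η) (by linarith)
    (bad := fun n v => ¬ (((-(η / 2) : ℝ) : EReal) <
      supGap F (G n.2) (√(k n.1 : ℝ) / ivtScale F k n.1) (1 / (n.2 : ℝ) ^ p) (1 - v) v ∧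
      supGap F (G n.2) (√(k n.1 : ℝ) / ivtScale F k n.1) (1 / (n.2 : ℝ) ^ p) (1 - v) v
        < ((η / 2 : ℝ) : EReal)))
  filter_upwards [hlev (-y + η), hlev (-y + 2 * η), hlev (-y - 2 * η), hlev (-y - η), hb1, hb2,
    hq1.eventually_lt_const (show -(-y + η) < y - η / 2 by linarith),
    hq2.eventually_const_lt (show y + η / 2 < -(-y - η) by linarith),
    hlN.eventually (hF.eventually_scale_pos hk hkN)]
    with n hl1 hl2 hl3 hl4 ⟨v, hv1, hv2, hv3⟩ ⟨w, hw1, hw2, hw3⟩ h1 h2 ha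
  simp only [Function.comp] at h1 h2
  rw [not_not] at hv3 hw3
  set a := √(k n.1 : ℝ) / ivtScale F k n.1
  set A := upperQuantile F ((k n.1 : ℝ) / n.1)
  constructor
  · have hle := h.le_exceedProb ha (hl3.1.trans hw1) (hw2.trans_lt hl4.2) hw3.1
    refine (hw1.le.trans hle).trans (exceedProb_antitone n.2 ?_)
    have hmono := antitoneOn_upperQuantile F (hl3.1.trans hw1) hw2 hl4.2
    rw [← div_lt_iff₀' ha, add_div] at h2
    rw [neg_div]
    linarith
  · have hle := h.exceedProb_le ha (hl1.1.trans hv1) (hv2.trans_lt hl2.2) hv3.2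
    refine le_trans (exceedProb_antitone n.2 ?_) (hle.trans hv2)
    have hmono := antitoneOn_upperQuantile F hl1.1 hv1.le (hv2.trans_lt hl2.2)
    rw [← lt_div_iff₀' ha, sub_div] at h1
    linarith

theorem IsSample.tendstoInDistribution_ivtStat [l.IsCountablyGenerated] (h : IsSample P θ ε F G)
    (hs : TESupFull P₀ U F G p k l) (hi : TEInf P₀ U F G p k l) :
    TendstoInDistribution (ivtStat θ ε F p k) l id (fun _ => P) (gaussianReal 0 1) := by
  refine tendstoInDistribution_of_tendsto_cdf (fun n => h.aemeasurable_ivtStat n) fun y => ?_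
  have hna : NullSingletonClass (gaussianReal 0 1) := nullSingletonClass_gaussianReal one_ne_zero
  have hcont := continuous_cdf_of_noAtoms (gaussianReal 0 1)
  have heq : ∀ᶠ n in l, P.real {ω | ivtStat θ ε F p k n ω ≤ y} = P₀.real {ω | hitCount U
      (Iic (exceedProb P θ ε p n.2 (upperQuantile F ((k n.1 : ℝ) / n.1)
        + y / (√(k n.1 : ℝ) / ivtScale F k n.1)))) n.1 ω ≤ k n.1} := by
    filter_upwards [hlN.eventually (eventually_lt_of_tendsto_div hk hkN),
      hlN.eventually (hF.eventually_ivtScale_pos hk hkN)] with n h1 h2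
    exact h.real_ivtStat_le hUindep hUlaw h1.1 h1.2 h2 y
  have hB := fun x => (tendsto_real_hitCount hk hkN hUindep hUlaw x).1.comp hlN
  rw [tendsto_order]
  constructor
  · intro c hc
    -- Continuity of the normal cdf lets the window shrink without losing the bound `c`.
    have h1 : Tendsto (fun η : ℝ => cdf (gaussianReal 0 1) (-(-y + 2 * η))) (𝓝[>] 0)
        (𝓝 (cdf (gaussianReal 0 1) y)) := by
      have : Continuous fun η : ℝ => cdf (gaussianReal 0 1) (-(-y + 2 * η)) := by fun_prop
      have := this.tendsto 0
      simp only [mul_zero, add_zero, neg_neg] at this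
      exact this.mono_left nhdsWithin_le_nhds
    obtain ⟨η, hη, hη0⟩ := ((h1.eventually_const_lt hc).and self_mem_nhdsWithin).exists
    filter_upwards [heq, (hB (-y + 2 * η)).eventually_const_lt hη,
      h.eventually_exceedProb_mem hF hk hkN hlN hUindep hUlaw hs hi y hη0] with n h2 h3 h4
    rw [h2]
    exact h3.trans_le (real_hitCount_antitone n.1 _ h4.2)
  · intro c hc
    have h1 : Tendsto (fun η : ℝ => cdf (gaussianReal 0 1) (-(-y - 2 * η))) (𝓝[>] 0)
        (𝓝 (cdf (gaussianReal 0 1) y)) := by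
      have : Continuous fun η : ℝ => cdf (gaussianReal 0 1) (-(-y - 2 * η)) := by fun_prop
      have := this.tendsto 0
      simp only [mul_zero, sub_zero, neg_neg] at this
      exact this.mono_left nhdsWithin_le_nhds
    obtain ⟨η, hη, hη0⟩ := ((h1.eventually_lt_const hc).and self_mem_nhdsWithin).exists
    filter_upwards [heq, (hB (-y - 2 * η)).eventually_lt_const hη,
      h.eventually_exceedProb_mem hF hk hkN hlN hUindep hUlaw hs hi y hη0] with n h2 h3 h4
    rw [h2]
    exact lt_of_le_of_lt (real_hitCount_antitone n.1 _ h4.1) h3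

end Transfer

/-! ### Extremal couplings by reversing part of the unit interval. -/

section Coupling

/-- The map of `ℝ` that reverses the interval `[c.1, c.2]` and fixes everything else. -/
def reverseOn (c : ℝ × ℝ) (w : ℝ) : ℝ := if w ∈ Icc c.1 c.2 then c.1 + c.2 - w else w

lemma reverseOn_of_mem {c : ℝ × ℝ} {w : ℝ} (h : w ∈ Icc c.1 c.2) : reverseOn c w = c.1 + c.2 - w := if_pos h

lemma reverseOn_mem_iff (c : ℝ × ℝ) (w : ℝ) : reverseOn c w ∈ Icc c.1 c.2 ↔ w ∈ Icc c.1 c.2 := by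
  by_cases h : w ∈ Icc c.1 c.2
  · rw [reverseOn_of_mem h]
    refine iff_of_true ?_ h
    constructor <;> linarith [h.1, h.2]
  · rw [reverseOn, if_neg h]

lemma measurable_reverseOn (c : ℝ × ℝ) : Measurable (reverseOn c) :=
  Measurable.ite measurableSet_Icc (by fun_prop) measurable_id

lemma measurePreserving_reverseOn (c : ℝ × ℝ) : MeasurePreserving (reverseOn c) volume volume := by
  refine ⟨measurable_reverseOn c, Measure.ext fun S hS => ?_⟩
  rw [Measure.map_apply (measurable_reverseOn c) hS]
  rw [← measure_inter_add_sdiff (reverseOn c ⁻¹' S) (measurableSet_Icc (a := c.1) (b := c.2)),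
    ← measure_inter_add_sdiff S (measurableSet_Icc (a := c.1) (b := c.2))]
  congr 1
  · have e : reverseOn c ⁻¹' S ∩ Icc c.1 c.2
        = (fun w => c.1 + c.2 - w) ⁻¹' (S ∩ Icc c.1 c.2) := by
      ext w
      simp only [mem_inter_iff, mem_preimage]
      constructor
      · rintro ⟨h1, h2⟩
        rw [reverseOn_of_mem h2] at h1
        exact ⟨h1, by constructor <;> linarith [h2.1, h2.2]⟩
      · rintro ⟨h1, h2⟩
        have h3 : w ∈ Icc c.1 c.2 := by constructor <;> linarith [h2.1, h2.2]
        rw [reverseOn_of_mem h3]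
        exact ⟨h1, h3⟩
    rw [e]
    exact (Measure.measurePreserving_sub_left volume (c.1 + c.2)).measure_preimage
      (hS.inter measurableSet_Icc).nullMeasurableSet
  · congr 1
    ext w
    simp only [Set.mem_sdiff, mem_preimage]
    refine and_congr_left fun h => ?_
    rw [reverseOn, if_neg h]

/-- The subintervals of `[0, 1]`. -/
def unitSub : Set (ℝ × ℝ) := {c | 0 ≤ c.1 ∧ c.2 ≤ 1}

lemma measurePreserving_reverseOn_uniform {c : ℝ × ℝ} (hc : c ∈ unitSub) :
    MeasurePreserving (reverseOn c) (volume.restrict (Icc (0 : ℝ) 1))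
      (volume.restrict (Icc (0 : ℝ) 1)) := by
  have h := (measurePreserving_reverseOn c).restrict_preimage (measurableSet_Icc (a := (0 : ℝ)) (b := 1))
  have e : reverseOn c ⁻¹' Icc 0 1 = Icc 0 1 := by
    ext w
    rw [mem_preimage]
    by_cases hw : w ∈ Icc c.1 c.2
    · have h2 := (reverseOn_mem_iff c w).2 hw
      exact iff_of_true ⟨hc.1.trans h2.1, h2.2.trans hc.2⟩ ⟨hc.1.trans hw.1, hw.2.trans hc.2⟩
    · rw [reverseOn, if_neg hw]
  rwa [e] at h

/-- The law of an infinite sequence of independent uniforms. -/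
def uniformSeq : Measure (ℕ → ℝ) := Measure.infinitePi fun _ => volume.restrict (Icc (0 : ℝ) 1)

instance : IsProbabilityMeasure uniformSeq := by unfold uniformSeq; infer_instance

/-- The latent variables `F⁻¹(W_i)`. -/
def coupledLatent (F : Measure ℝ) (i : ℕ) (ω : ℕ → ℝ) : ℝ := (quantile F (ω i)).toReal

/-- The noise `G_T⁻¹(reverseOn W_i)`. -/
def coupledNoise (G : ℕ → Measure ℝ) (R : ℕ → ℝ × ℝ) (i T : ℕ) (ω : ℕ → ℝ) : ℝ :=
  (quantile (G T) (reverseOn (R T) (ω i))).toReal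

variable (F : Measure ℝ) (G : ℕ → Measure ℝ) [IsProbabilityMeasure F]
  [∀ T, IsProbabilityMeasure (G T)] {R : ℕ → ℝ × ℝ}

/-- One uniform per index drives both coordinates. Reversal preserves the uniform law, so the noise
marginal is unaffected, and the latent variables do not depend on `T`. -/
lemma isSample_reverseOn (hR : ∀ T, R T ∈ unitSub) :
    IsSample uniformSeq (coupledLatent F) (coupledNoise G R) F G := by
  have hmeas : ∀ T, Measurable fun w : ℝ =>
      ((quantile F w).toReal, (quantile (G T) (reverseOn (R T) w)).toReal) := fun T =>
    (measurable_toReal_quantile F).prodMk ((measurable_toReal_quantile (G T)).comp (measurable_reverseOn _))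
  have heval : ∀ i : ℕ, HasLaw (fun ω : ℕ → ℝ => ω i) (volume.restrict (Icc (0 : ℝ) 1))
      uniformSeq := fun i =>
    ⟨(measurable_pi_apply i).aemeasurable, Measure.infinitePi_map_eval _ i⟩
  refine ⟨fun T => ?_, fun T i => ?_, fun i => ?_, fun i T => ?_⟩
  · exact iIndepFun_infinitePi (X := fun _ w =>
      ((quantile F w).toReal, (quantile (G T) (reverseOn (R T) w)).toReal)) fun _ => hmeas T
  · have : IdentDistrib (fun ω : ℕ → ℝ => ω i) (fun ω => ω 0) uniformSeq uniformSeq :=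
      ⟨(heval i).aemeasurable, (heval 0).aemeasurable, by rw [(heval i).map_eq, (heval 0).map_eq]⟩
    exact this.comp (hmeas T)
  · have h1 : HasLaw (fun q => (quantile F q).toReal) F (volume.restrict (Icc (0 : ℝ) 1)) :=
      ⟨(measurable_toReal_quantile F).aemeasurable, map_quantile_uniform F⟩
    exact h1.comp (heval i)
  · have h1 : HasLaw (fun q => (quantile (G T) q).toReal) (G T)
        (volume.restrict (Icc (0 : ℝ) 1)) :=
      ⟨(measurable_toReal_quantile (G T)).aemeasurable, map_quantile_uniform (G T)⟩
    have h2 := (measurePreserving_reverseOn_uniform (hR T)).hasLaw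
    exact (h1.comp h2).comp (heval i)

omit [IsProbabilityMeasure F] [∀ T, IsProbabilityMeasure (G T)] in
lemma exceedProb_reverseOn (p : ℝ) (T : ℕ) (t : ℝ) :
    exceedProb uniformSeq (coupledLatent F) (coupledNoise G R) p T t
      = (volume.restrict (Icc (0 : ℝ) 1)).real {w | t < (quantile F w).toReal
        + 1 / (T : ℝ) ^ p * (quantile (G T) (reverseOn (R T) w)).toReal} := by
  have hm : MeasurableSet {w | t < (quantile F w).toReal
        + 1 / (T : ℝ) ^ p * (quantile (G T) (reverseOn (R T) w)).toReal} :=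
    measurableSet_lt measurable_const ((measurable_toReal_quantile F).add
      (((measurable_toReal_quantile (G T)).comp (measurable_reverseOn _)).const_mul _))
  have h0 : HasLaw (fun ω : ℕ → ℝ => ω 0) (volume.restrict (Icc (0 : ℝ) 1)) uniformSeq :=
    ⟨(measurable_pi_apply 0).aemeasurable, Measure.infinitePi_map_eval _ 0⟩
  exact h0.measureReal_eq hm

variable {F G}

omit [IsProbabilityMeasure F] [∀ T, IsProbabilityMeasure (G T)] in
/-- Reversing `[1 - v, 1]` attains Makarov's upper bound. -/
lemma le_exceedProb_reverseOn {p a v δ δ' : ℝ} {T : ℕ} (ha : 0 < a) (hv0 : 0 < v) (hv1 : v < 1)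
    (hδ : δ' < δ) (hgap : (δ : EReal) ≤ infGap F (G T) a (1 / (T : ℝ) ^ p) v v)
    (hR : R T = (1 - v, 1)) :
    v ≤ exceedProb uniformSeq (coupledLatent F) (coupledNoise G R) p T (upperQuantile F v + δ' / a) := by
  rw [exceedProb_reverseOn]
  have hvol : (volume.restrict (Icc (0 : ℝ) 1)).real (Ioo (1 - v) 1) = v := by
    rw [measureReal_restrict_apply measurableSet_Ioo, inter_eq_left.2, Real.volume_real_Ioo_of_le]
    · ring
    · linarith
    · exact fun w hw => ⟨by linarith [hw.1], hw.2.le⟩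
  -- It suffices that every `w` in `(1 - v, 1)` exceeds the threshold: the infimum bound is used at
  -- `u = w - (1 - v)`, where reversal produces exactly the noise level `1 - u`.
  conv_lhs => rw [← hvol]
  refine measureReal_mono fun w hw => ?_
  rw [mem_Ioo] at hw
  have h1 := hgap.trans (iInf₂_le (w - (1 - v)) ⟨by linarith, by linarith⟩)
  have hfl : reverseOn (R T) w = 1 - (w - (1 - v)) := by
    rw [hR, reverseOn_of_mem ⟨hw.1.le, hw.2.le⟩]; ring
  rw [show 1 - v + (w - (1 - v)) = w by ring, ← hfl,
    ← coe_toReal_quantile F (q := w) (by linarith) hw.2,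
    ← coe_toReal_quantile F (q := 1 - v) (by linarith) (by linarith),
    ← coe_toReal_quantile (G T) (q := reverseOn (R T) w) (by rw [hfl]; linarith) (by rw [hfl]; linarith),
    coe_gap, EReal.coe_le_coe_iff] at h1
  have h2 := hδ.trans_le h1
  rw [← div_lt_iff₀' ha] at h2
  rw [mem_ofPred_eq, upperQuantile]
  linarith

omit [IsProbabilityMeasure F] [∀ T, IsProbabilityMeasure (G T)] in
/-- Reversing `[0, 1 - v]` attains Makarov's lower bound. -/
lemma exceedProb_reverseOn_le {p a v δ : ℝ} {T : ℕ} (ha : 0 < a) (hv0 : 0 < v) (hv1 : v < 1)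
    (hgap : supGap F (G T) a (1 / (T : ℝ) ^ p) (1 - v) v ≤ (δ : EReal))
    (hR : R T = (0, 1 - v)) :
    exceedProb uniformSeq (coupledLatent F) (coupledNoise G R) p T (upperQuantile F v + δ / a) ≤ v := by
  rw [exceedProb_reverseOn]
  -- No `w` in `(0, 1 - v)` can exceed the threshold, so exceedances lie in a complement of mass
  -- `v`.
  have hvol : (volume.restrict (Icc (0 : ℝ) 1)).real (Ioo 0 (1 - v))ᶜ = v := by
    rw [probReal_compl_eq_one_sub measurableSet_Ioo,
      measureReal_restrict_apply measurableSet_Ioo, inter_eq_left.2, Real.volume_real_Ioo_of_le]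
    · ring
    · linarith
    · exact fun w hw => ⟨hw.1.le, by linarith [hw.2]⟩
  refine (measureReal_mono fun w hw hw2 => ?_).trans_eq hvol
  rw [mem_Ioo] at hw2
  have h1 := (le_iSup₂ (f := fun u (_ : u ∈ Icc (0 : ℝ) (1 - v)) => (a : EReal) *
    (quantile F (1 - v - u) - quantile F (1 - v) +
      ((1 / (T : ℝ) ^ p : ℝ) : EReal) * quantile (G T) u)) (1 - v - w)
    ⟨by linarith, by linarith⟩).trans hgap
  have hfl : reverseOn (R T) w = 1 - v - w := by
    rw [hR, reverseOn_of_mem ⟨hw2.1.le, hw2.2.le⟩]; ring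
  rw [show 1 - v - (1 - v - w) = w by ring, ← hfl,
    ← coe_toReal_quantile F (q := w) hw2.1 (by linarith),
    ← coe_toReal_quantile F (q := 1 - v) (by linarith) (by linarith),
    ← coe_toReal_quantile (G T) (q := reverseOn (R T) w) (by rw [hfl]; linarith) (by rw [hfl]; linarith),
    coe_gap, EReal.coe_le_coe_iff, ← le_div_iff₀' ha] at h1
  rw [mem_ofPred_eq, upperQuantile] at hw
  linarith

end Coupling

/-! ### Failure of tail equivalence destroys the normal limit. -/

section Sharpness

variable {F : Measure ℝ} {G : ℕ → Measure ℝ} {p : ℝ} {k : ℕ → ℕ} {l : Filter (ℕ × ℕ)}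
  {Ω₀ : Type*} [MeasurableSpace Ω₀] {P₀ : Measure Ω₀} {U : ℕ → Ω₀ → ℝ}

/-- One of the two gaps at the level `v` is not within `(-δ, δ)`. -/
def LargeGap (F : Measure ℝ) (G : ℕ → Measure ℝ) (p : ℝ) (k : ℕ → ℕ) (δ : ℝ) (n : ℕ × ℕ)
    (v : ℝ) : Prop :=
  ¬ (((-δ : ℝ) : EReal) <
      infGap F (G n.2) (√(k n.1 : ℝ) / ivtScale F k n.1) (1 / (n.2 : ℝ) ^ p) v v ∧
      infGap F (G n.2) (√(k n.1 : ℝ) / ivtScale F k n.1) (1 / (n.2 : ℝ) ^ p) v v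
        < ((δ : ℝ) : EReal)) ∨
  ¬ (((-δ : ℝ) : EReal) <
      supGap F (G n.2) (√(k n.1 : ℝ) / ivtScale F k n.1) (1 / (n.2 : ℝ) ^ p) (1 - v) v ∧
      supGap F (G n.2) (√(k n.1 : ℝ) / ivtScale F k n.1) (1 / (n.2 : ℝ) ^ p) (1 - v) v
        < ((δ : ℝ) : EReal))

/-- At a level with a large gap, a suitable coupling shifts the quantile. -/
lemma LargeGap.exists_coupling [IsProbabilityMeasure F] [∀ T, IsProbabilityMeasure (G T)]
    {δ : ℝ} (hδ : 0 < δ) {n : ℕ × ℕ} {v : ℝ} (hbad : LargeGap F G p k δ n v)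
    (ha : 0 < √(k n.1 : ℝ) / ivtScale F k n.1) (hv0 : 0 < v) (hv1 : v < 1) :
    ∃ c ∈ unitSub, ∀ R : ℕ → ℝ × ℝ, (∀ T, R T ∈ unitSub) → R n.2 = c →
      v ≤ exceedProb uniformSeq (coupledLatent F) (coupledNoise G R) p n.2
        (upperQuantile F v + (δ / 2) / (√(k n.1 : ℝ) / ivtScale F k n.1)) ∨
      exceedProb uniformSeq (coupledLatent F) (coupledNoise G R) p n.2
        (upperQuantile F v + (-(δ / 2)) / (√(k n.1 : ℝ) / ivtScale F k n.1)) ≤ v := by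
  have h00 : ((0, 0) : ℝ × ℝ) ∈ unitSub := ⟨le_rfl, zero_le_one⟩
  have hneg : ((-δ : ℝ) : EReal) < ((-(δ / 2) : ℝ) : EReal) := by
    rw [EReal.coe_lt_coe_iff]; linarith
  have hpos : ((δ / 2 : ℝ) : EReal) < ((δ : ℝ) : EReal) := by
    rw [EReal.coe_lt_coe_iff]; linarith
  -- For an infimum gap `≤ -δ` or a supremum gap `≥ δ`, Makarov's inequality already shifts the
  -- quantile under every coupling, and the trivial interval suffices. The other two cases need the
  -- extremal reversals.
  rcases hbad with h | h <;> rw [not_and_or, not_lt, not_lt] at h <;> rcases h with h | h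
  · exact ⟨(0, 0), h00, fun R hR _ => Or.inr
      ((isSample_reverseOn F G hR).exceedProb_le ha hv0 hv1 (h.trans_lt hneg))⟩
  · exact ⟨(1 - v, 1), ⟨by simp; linarith, le_rfl⟩, fun R _ hc => Or.inl
      (le_exceedProb_reverseOn ha hv0 hv1 (half_lt_self hδ) h hc)⟩
  · exact ⟨(0, 1 - v), ⟨le_rfl, by simp; linarith⟩, fun R _ hc => Or.inr
      (exceedProb_reverseOn_le ha hv0 hv1 (h.trans hneg.le) hc)⟩
  · exact ⟨(0, 0), h00, fun R hR _ => Or.inl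
      ((isSample_reverseOn F G hR).le_exceedProb ha hv0 hv1 (hpos.trans_le h))⟩

lemma monotone_lev (k : ℕ → ℕ) (N : ℕ) : Monotone fun x => lev k x N := by
  intro x y hxy
  unfold lev
  beta_reduce
  gcongr

variable [IsProbabilityMeasure P₀] [IsProbabilityMeasure F] [∀ T, IsProbabilityMeasure (G T)]
  {Ω : Type*} [MeasurableSpace Ω] {P : Measure Ω} [IsProbabilityMeasure P]
  {θ : ℕ → Ω → ℝ} {ε : ℕ → ℕ → Ω → ℝ}
  (hF : VonMises F) (hk : Tendsto k atTop atTop)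
  (hkN : Tendsto (fun N : ℕ => (k N : ℝ) / N) atTop (𝓝 0))
  (hlN : Tendsto Prod.fst l atTop) (hUindep : iIndepFun U P₀)
  (hUlaw : ∀ i, HasLaw (U i) (volume.restrict (Icc (0 : ℝ) 1)) P₀)

include hF hk hkN hlN hUindep hUlaw

omit [IsProbabilityMeasure F] [∀ T, IsProbabilityMeasure (G T)] in
/-- The quantiles of the noisy observations cannot be shifted along the sequence `m` when the
noisy order statistic is asymptotically standard normal. -/
lemma IsSample.false_of_shift (h : IsSample P θ ε F G)
    (hconv : TendstoInDistribution (ivtStat θ ε F p k) l id (fun _ => P) (gaussianReal 0 1))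
    {f : Filter ℕ} [f.NeBot] {m : ℕ → ℕ × ℕ} (hm : Tendsto m f l) {x : ℕ → ℝ} {x₀ : ℝ}
    (hx : Tendsto x f (𝓝 x₀)) {δ : ℝ} (hδ : 0 < δ)
    (hshift : (∀ᶠ j in f, lev k (x j) (m j).1 ≤ exceedProb P θ ε p (m j).2
        (upperQuantile F (lev k (x j) (m j).1)
          + (δ / 2) / (√(k (m j).1 : ℝ) / ivtScale F k (m j).1))) ∨
      (∀ᶠ j in f, exceedProb P θ ε p (m j).2 (upperQuantile F (lev k (x j) (m j).1)
          + (-(δ / 2)) / (√(k (m j).1 : ℝ) / ivtScale F k (m j).1)) ≤ lev k (x j) (m j).1)) :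
    False := by
  have hna : NullSingletonClass (gaussianReal 0 1) := nullSingletonClass_gaussianReal one_ne_zero
  have hmN : Tendsto (fun j => (m j).1) f atTop := hlN.comp hm
  have hcdf := fun y => (tendsto_cdf_of_tendstoInDistribution hconv y).comp hm
  have hB := fun x => (tendsto_real_hitCount hk hkN hUindep hUlaw x).1.comp hmN
  have hlev := fun x => hmN.eventually (eventually_lev_mem hk hkN x)
  have hq := fun x => (hF.tendsto_upperQuantile hk hkN x).comp hmN
  have hx1 := hx.eventually_lt_const (show x₀ < x₀ + δ / 16 by linarith)
  have hx2 := hx.eventually_const_lt (show x₀ - δ / 16 < x₀ by linarith)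
  have hbase := (hmN.eventually (eventually_lt_of_tendsto_div hk hkN)).and
    (hmN.eventually (hF.eventually_ivtScale_pos hk hkN))
  rcases hshift with hs | hs
  -- The shift `δ/2` outweighs the loss `δ/8` in locating the quantile, so it survives at `y = -x₀ +
  -- δ/4`. There the limiting cdf would be at most its value at `-x₀ + δ/16`, against strict
  -- monotonicity.
  · have hle : cdf (gaussianReal 0 1) (-x₀ + δ / 4) ≤ cdf (gaussianReal 0 1) (-(x₀ - δ / 16)) := by
      refine le_of_tendsto_of_tendsto (hcdf _) (hB _) ?_
      filter_upwards [hs, hx1, hx2, hlev (x₀ - δ / 16), hlev (x₀ + δ / 16), hbase,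
        (hq (x₀ + δ / 16)).eventually_const_lt
          (show -x₀ - δ / 8 < -(x₀ + δ / 16) by linarith),
        hmN.eventually (hF.eventually_scale_pos hk hkN)] with j h1 h2 h3 h4 h5 h6 h7 ha
      simp only [Function.comp] at h7 ⊢
      rw [h.real_ivtStat_le hUindep hUlaw h6.1.1 h6.1.2 h6.2]
      refine real_hitCount_antitone (m j).1 _ ?_
      have hl := monotone_lev k (m j).1 h3.le
      have hu := monotone_lev k (m j).1 h2.le
      beta_reduce at hl hu
      refine hl.trans (h1.trans (exceedProb_antitone _ ?_))
      have hmono := antitoneOn_upperQuantile F (h4.1.trans_le hl) hu h5.2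
      rw [← div_lt_iff₀' ha] at h7
      set a := √(k (m j).1 : ℝ) / ivtScale F k (m j).1
      have h8 : (-x₀ + δ / 4) / a ≤ (-x₀ - δ / 8) / a + δ / 2 / a := by
        rw [← add_div]
        exact div_le_div_of_nonneg_right (by linarith) ha.le
      linarith
    have := strictMono_cdf_gaussianReal.le_iff_le.1 hle
    linarith
  · have hle : cdf (gaussianReal 0 1) (-(x₀ + δ / 16)) ≤ cdf (gaussianReal 0 1) (-x₀ - δ / 4) := by
      refine le_of_tendsto_of_tendsto (hB _) (hcdf _) ?_
      filter_upwards [hs, hx1, hx2, hlev (x₀ - δ / 16), hlev (x₀ + δ / 16), hbase,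
        (hq (x₀ - δ / 16)).eventually_lt_const
          (show -(x₀ - δ / 16) < -x₀ + δ / 8 by linarith),
        hmN.eventually (hF.eventually_scale_pos hk hkN)] with j h1 h2 h3 h4 h5 h6 h7 ha
      simp only [Function.comp] at h7 ⊢
      rw [h.real_ivtStat_le hUindep hUlaw h6.1.1 h6.1.2 h6.2]
      refine real_hitCount_antitone (m j).1 _ ?_
      have hl := monotone_lev k (m j).1 h3.le
      have hu := monotone_lev k (m j).1 h2.le
      beta_reduce at hl hu
      refine (le_trans (exceedProb_antitone _ ?_) h1).trans hu
      have hmono := antitoneOn_upperQuantile F h4.1 hl (hu.trans_lt h5.2)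
      rw [← lt_div_iff₀' ha] at h7
      set a := √(k (m j).1 : ℝ) / ivtScale F k (m j).1
      have h8 : (-x₀ + δ / 8) / a + -(δ / 2) / a ≤ (-x₀ - δ / 4) / a := by
        rw [← add_div]
        exact div_le_div_of_nonneg_right (by linarith) ha.le
      linarith
    have := strictMono_cdf_gaussianReal.le_iff_le.1 hle
    linarith

omit [IsProbabilityMeasure F] [∀ T, IsProbabilityMeasure (G T)] hF hlN in
/-- Events of non-vanishing probability contain levels at a bounded standardized distance. -/
lemma frequently_exists_level (hlN : Tendsto Prod.fst l atTop) {bad : ℕ × ℕ → ℝ → Prop}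
    (hbad : ¬ Tendsto (fun n : ℕ × ℕ => P₀ {ω | bad n (orderStat (fun i => U i ω) n.1 (k n.1))}) l
      (𝓝 0)) :
    ∃ M : ℝ, ∃ᶠ n in l, ∃ v, lev k (-M) n.1 < v ∧ v ≤ lev k M n.1 ∧ bad n v := by
  rw [ENNReal.tendsto_nhds_zero] at hbad
  push Not at hbad
  obtain ⟨η, hη, hfreq⟩ := hbad
  obtain ⟨r, hr0, hr⟩ := ENNReal.lt_iff_exists_real_btwn.1 hη
  have hr1 : 0 < r := by simpa using hr.1
  -- `U_{k,N}` leaves the window `±M` with limiting probability below `r`, so a bad event of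
  -- probability at least `r` must meet the window.
  have hM : ∃ M : ℝ, 1 - r < cdf (gaussianReal 0 1) M - cdf (gaussianReal 0 1) (-M) := by
    have h1 := (tendsto_cdf_atTop (gaussianReal 0 1)).sub
      ((tendsto_cdf_atBot (gaussianReal 0 1)).comp tendsto_neg_atTop_atBot)
    exact (h1.eventually_const_lt (by linarith)).exists
  obtain ⟨M, hM⟩ := hM
  refine ⟨M, ?_⟩
  have h1 := ((tendsto_real_orderStat_le hUindep hUlaw hk hkN M).sub
    (tendsto_real_orderStat_le hUindep hUlaw hk hkN (-M))).comp hlN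
  rw [neg_neg] at h1
  have h2 := h1.eventually_const_lt (show 1 - r < _ by linarith)
  refine (hfreq.and_eventually h2).mono fun n hn => ?_
  obtain ⟨hn1, hn2⟩ := hn
  by_contra hcon
  push Not at hcon
  simp only [Function.comp] at hn2
  have hsub : {ω | bad n (orderStat (fun i => U i ω) n.1 (k n.1))} ⊆
      {ω | orderStat (fun i => U i ω) n.1 (k n.1) ≤ lev k (-M) n.1} ∪
      {ω | orderStat (fun i => U i ω) n.1 (k n.1) ≤ lev k M n.1}ᶜ := by
    intro ω hω
    by_contra hnot
    simp only [mem_union, mem_compl_iff, mem_ofPred_eq, not_or, not_lt, not_le] at hnot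
    exact hcon _ hnot.1 hnot.2 hω
  have hmeas : NullMeasurableSet {ω | orderStat (fun i => U i ω) n.1 (k n.1) ≤ lev k M n.1} P₀ :=
    ((measurable_orderStat n.1 (k n.1)).comp_aemeasurable
      (aemeasurable_pi_iff.2 fun i => (hUlaw i).aemeasurable)).nullMeasurable measurableSet_Iic
  have h3 := (measureReal_mono (μ := P₀) hsub).trans (measureReal_union_le _ _)
  rw [probReal_compl_eq_one_sub₀ hmeas] at h3
  have h4 : r ≤ P₀.real {ω | bad n (orderStat (fun i => U i ω) n.1 (k n.1))} := by
    rw [measureReal_def]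
    refine (ENNReal.ofReal_le_iff_le_toReal (measure_ne_top _ _)).1 ?_
    exact (hr.2.trans hn1).le
  linarith

/-- The coupling may change with `T` but not with `N`, so bad pairs are selected with distinct
values of `T`, one reversal being prescribed for each. -/
theorem exists_coupling_not_tendsto [l.IsCountablyGenerated] (hlT : Tendsto Prod.snd l atTop)
    (hfail : ¬ (TEInf P₀ U F G p k l ∧ TESupFull P₀ U F G p k l)) :
    ∃ R : ℕ → ℝ × ℝ, (∀ T, R T ∈ unitSub) ∧
      ¬ TendstoInDistribution (ivtStat (coupledLatent F) (coupledNoise G R) F p k) l id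
        (fun _ => uniformSeq) (gaussianReal 0 1) := by
  obtain ⟨δ, hδ, hbad⟩ : ∃ δ > 0, ¬ Tendsto (fun n : ℕ × ℕ =>
      P₀ {ω | LargeGap F G p k δ n (orderStat (fun i => U i ω) n.1 (k n.1))}) l (𝓝 0) := by
    by_contra hcon
    push Not at hcon
    refine hfail ⟨fun δ hδ => ?_, fun δ hδ => ?_⟩
    · exact tendsto_of_tendsto_of_tendsto_of_le_of_le tendsto_const_nhds (hcon δ hδ)
        (fun _ => zero_le) fun n => measure_mono fun ω hω => Or.inl hω
    · exact tendsto_of_tendsto_of_tendsto_of_le_of_le tendsto_const_nhds (hcon δ hδ)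
        (fun _ => zero_le) fun n => measure_mono fun ω hω => Or.inr hω
  obtain ⟨M, hfreq⟩ := frequently_exists_level hk hkN hUindep hUlaw hlN hbad
  have hev : ∀ᶠ n in l, 0 < √(k n.1 : ℝ) / ivtScale F k n.1 ∧ lev k (-M) n.1 ∈ Ioo (0 : ℝ) 1 ∧
      lev k M n.1 ∈ Ioo (0 : ℝ) 1 ∧ 0 < k n.1 ∧ k n.1 < n.1 := by
    filter_upwards [hlN.eventually (hF.eventually_scale_pos hk hkN),
      hlN.eventually (eventually_lev_mem hk hkN (-M)), hlN.eventually (eventually_lev_mem hk hkN M),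
      hlN.eventually (eventually_lt_of_tendsto_div hk hkN)] with n h1 h2 h3 h4
    exact ⟨h1, h2, h3, h4⟩
  obtain ⟨ns, hns, hprop⟩ := exists_seq_forall_of_frequently (hfreq.and_eventually hev)
  -- Strict growth of `T` prevents conflicting prescriptions; elsewhere the degenerate interval `(0,
  -- 0)` is used.
  obtain ⟨φ, hφ, hmono⟩ := strictMono_subseq_of_tendsto_atTop (hlT.comp hns)
  have hdata : ∀ j, ∃ x ∈ Icc (-M) M, LargeGap F G p k δ (ns (φ j)) (lev k x (ns (φ j)).1) ∧
      0 < lev k x (ns (φ j)).1 ∧ lev k x (ns (φ j)).1 < 1 := by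
    intro j
    obtain ⟨⟨v, hv1, hv2, hv3⟩, -, hl1, hl2, hk0, hkn⟩ := hprop (φ j)
    set N := (ns (φ j)).1
    have hkp : (0 : ℝ) < k N := by exact_mod_cast hk0
    have hNp : (0 : ℝ) < N := by exact_mod_cast hk0.trans hkn
    have hs : 0 < √(k N : ℝ) := Real.sqrt_pos.2 hkp
    have hx : lev k ((v * N - k N) / √(k N : ℝ)) N = v := by
      unfold lev
      field_simp
      ring
    refine ⟨(v * N - k N) / √(k N : ℝ), ⟨?_, ?_⟩, ?_, ?_, ?_⟩
    · rw [le_div_iff₀ hs]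
      rw [lev, div_lt_iff₀ hNp] at hv1
      linarith
    · rw [div_le_iff₀ hs]
      rw [lev, le_div_iff₀ hNp] at hv2
      linarith
    · rwa [hx]
    · rw [hx]; exact hl1.1.trans hv1
    · rw [hx]; exact hv2.trans_lt hl2.2
  choose x hxM hxbad hx0 hx1 using hdata
  choose c hc hcR using fun j => (hxbad j).exists_coupling hδ (hprop (φ j)).2.1 (hx0 j) (hx1 j)
  set m : ℕ → ℕ × ℕ := fun j => ns (φ j)
  have hinj : Function.Injective fun j => (m j).2 := hmono.injective
  set R : ℕ → ℝ × ℝ := Function.extend (fun j => (m j).2) c fun _ => (0, 0) with hRdef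
  have hRm : ∀ j, R (m j).2 = c j := fun j => hinj.extend_apply c _ j
  have hRunit : ∀ T, R T ∈ unitSub := by
    intro T
    by_cases hT : ∃ j, (m j).2 = T
    · obtain ⟨j, rfl⟩ := hT
      rw [hRm]; exact hc j
    · rw [hRdef, Function.extend_apply' _ _ _ hT]
      exact ⟨le_rfl, zero_le_one⟩
  refine ⟨R, hRunit, fun hconv => ?_⟩
  -- An ultrafilter makes the bounded standardized levels converge and at the same time decides
  -- which direction of shift holds eventually.
  have hm : Tendsto m (hyperfilter ℕ : Filter ℕ) l :=
    (hns.comp hφ.tendsto_atTop).mono_left Nat.hyperfilter_le_atTop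
  obtain ⟨x₀, -, hx₀⟩ := isCompact_Icc.ultrafilter_le_nhds' ((hyperfilter ℕ).map x)
    (Ultrafilter.mem_map.2 (univ_mem' hxM))
  refine (isSample_reverseOn F G hRunit).false_of_shift hF hk hkN hlN hUindep hUlaw hconv hm hx₀ hδ ?_
  rw [← Ultrafilter.eventually_or]
  exact Eventually.of_forall fun j => hcR j R hRunit (hRm j)

end Sharpness

end

theorem theorem2
    (F : Measure ℝ) [IsProbabilityMeasure F]
    (G : ℕ → Measure ℝ) [∀ T, IsProbabilityMeasure (G T)]
    (hF : VonMises F) (p : ℝ) (hp : 0 < p)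
    (k : ℕ → ℕ) (hk : Tendsto k atTop atTop)
    (hkN : Tendsto (fun N : ℕ => (k N : ℝ) / N) atTop (𝓝 0))
    -- the mode in which `N, T → ∞`: jointly (the product filter) or along any path
    (l : Filter (ℕ × ℕ)) [l.IsCountablyGenerated]
    (hlN : Tendsto Prod.fst l atTop) (hlT : Tendsto Prod.snd l atTop)
    -- iid uniform random variables
    {Ω₀ : Type*} [MeasurableSpace Ω₀] (P₀ : Measure Ω₀) [IsProbabilityMeasure P₀]
    (U : ℕ → Ω₀ → ℝ) (hUindep : iIndepFun U P₀)
    (hUlaw : ∀ i, HasLaw (U i) (volume.restrict (Icc (0 : ℝ) 1)) P₀) :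
    -- (1) transferral of convergence
    ((∃ ε : ℝ, 0 < ε ∧ TESup P₀ U F G p k l ε) → TEInf P₀ U F G p k l →
      ∀ {Ω : Type*} [MeasurableSpace Ω] (P : Measure Ω) [IsProbabilityMeasure P]
        (θ : ℕ → Ω → ℝ) (ε : ℕ → ℕ → Ω → ℝ), IsSample P θ ε F G →
        TendstoInDistribution (ivtStat θ ε F p k) l id (fun _ => P) (gaussianReal 0 1)) ∧
    -- (2)(i) the two conditions of (1) imply the full-range supremum condition
    ((∃ ε : ℝ, 0 < ε ∧ TESup P₀ U F G p k l ε) → TEInf P₀ U F G p k l →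
      TESupFull P₀ U F G p k l) ∧
    -- (2)(ii) sharpness
    (¬ (TEInf P₀ U F G p k l ∧ TESupFull P₀ U F G p k l) →
      ∃ (Ω : Type) (_ : MeasurableSpace Ω) (P : Measure Ω) (_ : IsProbabilityMeasure P)
        (θ : ℕ → Ω → ℝ) (ε : ℕ → ℕ → Ω → ℝ), IsSample P θ ε F G ∧
        ¬ TendstoInDistribution (ivtStat θ ε F p k) l id (fun _ => P) (gaussianReal 0 1)) := by
  refine ⟨fun ⟨s, _, hs⟩ hi {Ω} _ P _ θ ε h => ?_, fun ⟨s, _, hs⟩ hi => ?_, fun hfail => ?_⟩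
  · exact h.tendstoInDistribution_ivtStat hF hk hkN hlN hUindep hUlaw
      (TESup.full hF hk hkN hlN hs hi) hi
  · exact TESup.full hF hk hkN hlN hs hi
  · obtain ⟨R, hR, hnot⟩ := exists_coupling_not_tendsto hF hk hkN hlN hUindep hUlaw hlT hfail
    exact ⟨ℕ → ℝ, inferInstance, uniformSeq, inferInstance, coupledLatent F, coupledNoise G R,
      isSample_reverseOn F G hR, hnot⟩
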